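/- All Banach spaces are real and of dimension at least $1$, and all topological spaces are Hausdorff. Let $K$ be a compact space, $E$ a Banach space, and $\mathcal H$ a closed linear subspace of $\mathcal C(K,E)$, the space of continuous functions $K\to E$ with the supremum norm. We use the following notions. - For $f\in\mathcal C(K)=\mathcal C(K,\mathbb R)$ and $e\in E$, $f\otimes e\in\mathcal C(K,E)$ is the function $x\mapsto f(x)e$. Let $\mathcal A\subseteq\mathcal C(K)$ be the closed linear span of the functions $e^*\circ h$ with $h\in\mathcal H$, $e^*\in E^*$, and let $\mathcal A^E$ be the set of all $f\in\mathcal A$ such that $f\otimes e\in\mathcal H$ for each $e\in E$. - The Choquet boundary $\operatorname{Ch}_{\mathcal H}K$ is the set of all $x\in K$ such that the functional $f\mapsto f(x)$ on $\mathcal A$ is an extreme point of the closed unit ball of $\mathcal A^*$. - A point $x\in K$ is a weak peak point with respect to $\mathcal H$ if for each neighbourhood $U$ of $x$ and each $\varepsilon\in(0,1)$ there exists $h\in\mathcal A^E$ with $0\le h\le 1$, $h(x)>1-\varepsilon$ and $h<\varepsilon$ on $\operatorname{Ch}_{\mathcal H}K\setminus U$. The set of weak peak points is denoted by $\mathcal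 W_{\mathcal H}$. - $\Omega_{\mathcal H}=\{y\in K:\ g(y)\ne0\text{ for some }g\in\mathcal H\}$. - A set $\mathcal B\subseteq K$ is a boundary for $\mathcal H$ if $\|h\|=\sup_{x\in\mathcal B}\|h(x)\|$ for each $h\in\mathcal H$. - For a set $S\subseteq K$, regarded as a topological space with the subspace topology, $S^{(0)}=S$ and $S^{(j+1)}$ is the set of those points of $S^{(j)}$ that are accumulation points of $S^{(j)}$. - A Banach space $Y$ contains an isomorphic copy of a Banach space $X$ if $X$ is linearly homeomorphic to a subspace of $Y$. An into isomorphism $T:X\to Y$ is a linear homeomorphism of $X$ onto a subspace $T(X)$ of $Y$, and $T^{-1}:T(X)\to X$ is its inverse. **Theorem 1.3.** For $i=1,2$, let $K_i$ be a compact space, $E_i$ a Banach space and $\mathcal H_i$ a closed subspace of $\mathcal C(K_i,E_i)$. Let $E_2$ contain no isomorphic copy of $c_0$, let $\mathcal B$ be a closed boundary for $\mathcal H_2$, and let $T:\mathcal H_1\to\mathcal H_2$ be an into isomorphism. Let $l\ge k\ge1$ be integers. Suppose that one of the following conditions holds: (i) $\mathcal W_{\mathcal H_1}^{(l)}$ is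 nonempty and $\mathcal B^{(k)}\cap\Omega_{\mathcal H_2}$ is empty; (ii) $\mathcal W_{\mathcal H_1}^{(l)}$ is infinite and $\mathcal B^{(k)}\cap\Omega_{\mathcal H_2}$ is finite; (iii) $\mathcal W_{\mathcal H_1}^{(l)}$ and $\mathcal B^{(k)}\cap\Omega_{\mathcal H_2}$ are both finite, and $E_2^m$ contains no isomorphic copy of $E_1^n$, where $n=|\mathcal W_{\mathcal H_1}^{(l)}|$ and $m=|\mathcal B^{(k)}\cap\Omega_{\mathcal H_2}|$. Then $$\|T\|\,\|T^{-1}\|\ \ge\ \max\Bigl\{3,\ \frac{2l+2-k}{k}\Bigr\}.$$ -/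

import Mathlib

set_option maxSynthPendingDepth 10

open Set Topology

/-- `Y` contains an isomorphic copy of `X`: `X` is linearly homeomorphic to a linear subspace
of `Y` (which is automatically closed when `X` is complete). -/
def ContainsCopy (Y X : Type*) [NormedAddCommGroup Y] [NormedSpace ℝ Y]
    [NormedAddCommGroup X] [NormedSpace ℝ X] : Prop :=
  ∃ F : Submodule ℝ Y, Nonempty (X ≃L[ℝ] F)

section FunctionSpaces

/- `C(K, E)` carries the supremum norm, as `K` is compact. -/
variable {K E : Type*} [TopologicalSpace K] [CompactSpace K]
  [NormedAddCommGroup E] [NormedSpace ℝ E]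

/-- The function `f ⊗ e`, that is `x ↦ f x • e`. -/
def tensorVec (f : C(K, ℝ)) (e : E) : C(K, E) :=
  ⟨fun x => f x • e, by fun_prop⟩

/-- The canonical scalar function space `𝒜` of `H`: the closed linear span in `C(K, ℝ)` of the
functions `x ↦ φ (h x)`, where `h ∈ H` and `φ` is in the dual of `E`. -/
noncomputable def scalarSpace (H : Submodule ℝ C(K, E)) : Submodule ℝ C(K, ℝ) :=
  (Submodule.span ℝ
    {f : C(K, ℝ) | ∃ φ : StrongDual ℝ E, ∃ h ∈ H, ∀ x, f x = φ (h x)}).topologicalClosure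

/-- The set `𝒜^E` of those `f ∈ 𝒜` such that `f ⊗ e ∈ H` for every `e ∈ E`. -/
def tensorMultipliers (H : Submodule ℝ C(K, E)) : Set C(K, ℝ) :=
  {f | f ∈ scalarSpace H ∧ ∀ e : E, tensorVec f e ∈ H}

/-- The evaluation functional `h ↦ h x` on a subspace `A` of `C(K, ℝ)`. -/
noncomputable def evalOn (A : Submodule ℝ C(K, ℝ)) (x : K) : StrongDual ℝ A :=
  (ContinuousMap.evalCLM ℝ x).comp A.subtypeL

/-- The Choquet boundary of `H`: the points `x` whose evaluation functional is an extreme point of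
the closed unit ball of the dual of the canonical scalar function space of `H`. -/
def choquetBoundary (H : Submodule ℝ C(K, E)) : Set K :=
  {x | evalOn (scalarSpace H) x ∈
    (Metric.closedBall (0 : StrongDual ℝ (scalarSpace H)) 1).extremePoints ℝ}

/-- The set `𝒲_H` of weak peak points with respect to `H`. -/
def weakPeakPoints (H : Submodule ℝ C(K, E)) : Set K :=
  {x | ∀ U ∈ 𝓝 x, ∀ ε : ℝ, 0 < ε → ε < 1 →
    ∃ h ∈ tensorMultipliers H, (∀ y, 0 ≤ h y ∧ h y ≤ 1) ∧ 1 - ε < h x ∧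
      ∀ y ∈ choquetBoundary H \ U, h y < ε}

/-- The set `Ω_H` of points at which some member of `H` does not vanish. -/
def nonvanishingSet (H : Submodule ℝ C(K, E)) : Set K :=
  {y | ∃ g ∈ H, g y ≠ 0}

/-- `B` is a boundary for `H`: `‖h‖ = sup_{x ∈ B} ‖h x‖` for every `h ∈ H`. (The supremum is that
of a bounded set of nonnegative reals, and is `0` when `B` is empty.) -/
def IsBoundaryFor (B : Set K) (H : Submodule ℝ C(K, E)) : Prop :=
  ∀ h ∈ H, ‖h‖ = ⨆ x : B, ‖h x‖

end FunctionSpaces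

/-!
Write `R` for `T` regarded as a map into `C(K₂, E₂)`. By Milman's theorem the members of `H₁` attain
their norms on the Choquet boundary, so an estimate there is an estimate of the norm.

Every point of `𝒲^(r+1)` is a limit of points of `𝒲^(r)`. Descending from `𝒲^(l)` to `𝒲^(0)` one
finds, for a unit vector `e` and `δ > 0`, functions `h 0, …, h l` of norm about one which are nested
(on the Choquet boundary `h i` is nearly `e` wherever `h j` with `j > i` is not small) and nearly
equal to `e` at a common point. Functions peaking in pairwise disjoint open sets form a weakly
unconditionally Cauchy series, and `E₂` contains no `c₀`, so by Bessaga-Pełczyński each new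
`R (h j)` with `j > 0` can be made small at finitely many prescribed points. Choosing for these the
points of `B ∩ Ω` where too many of the previous images are large (finitely many, as the derivatives
of `B` are compact), one achieves that at a point of `B^(j)` at most `k - j` of the images have norm
at least `δ`. The three cases of the hypothesis provide `h 0`.

Nestedness makes `2 h j - h i` for `i < j`, and `2 h l - (2 h i - h 0)` for `0 < i < l`, of norm
about one. At each `y ∈ B` some `R (h i) y` with `i ≤ k` is small, which has two consequences.
* `2 h l + h 0` has norm about `3`, but differs by `2 h i` from a function of norm about one, so its
  image has norm at most about `‖R‖` at `y`.
* `h 0 + ⋯ + h (k - 1) + 2 (h k + ⋯ + h l)` has norm about `2 l + 2 - k`. At most `k` of the terms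
  of its image are large at `y`, and each of these has norm at most about `‖R‖`: for `j ≥ k` with
  `R (h j) y` large, compare `2 h j` with `2 h j - h i`.
-/

section Milman

variable {V : Type*} [AddCommGroup V] [Module ℝ V]

theorem notMem_convexHull_of_mem_extremePoints {C s : Set V} {p : V} (hC : Convex ℝ C)
    (hp : p ∈ C.extremePoints ℝ) (hs : s ⊆ C) (hps : p ∉ s) : p ∉ convexHull ℝ s := fun hmem =>
  hps (extremePoints_convexHull_subset
    (inter_extremePoints_subset_extremePoints_of_subset (convexHull_min hs hC) ⟨hmem, hp⟩))

theorem isCompact_convexHull_union [TopologicalSpace V] [ContinuousAdd V] [ContinuousSMul ℝ V]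
    {s t : Set V} (hs : IsCompact s) (ht : IsCompact t) (hs' : Convex ℝ s) (ht' : Convex ℝ t) :
    IsCompact (convexHull ℝ (s ∪ t)) := by
  rcases s.eq_empty_or_nonempty with rfl | hsn
  · simpa only [empty_union, ht'.convexHull_eq] using ht
  rcases t.eq_empty_or_nonempty with rfl | htn
  · simpa only [union_empty, hs'.convexHull_eq] using hs
  have himage : convexHull ℝ (s ∪ t) =
      (fun p : (V × V) × ℝ => (1 - p.2) • p.1.1 + p.2 • p.1.2) '' ((s ×ˢ t) ×ˢ Icc 0 1) := by
    rw [hs'.convexHull_union ht' hsn htn]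
    ext v
    simp only [mem_convexJoin, segment_eq_image, mem_image, Prod.exists, mem_prod]
    grind
  rw [himage]
  exact ((hs.prod ht).prod isCompact_Icc).image (by fun_prop)

variable [TopologicalSpace V] [IsTopologicalAddGroup V] [ContinuousSMul ℝ V]
  [LocallyConvexSpace ℝ V] [T2Space V]

theorem exists_isCompact_convex_mem_nhdsWithin {C : Set V} (hC : IsCompact C) (hC' : Convex ℝ C)
    {p q : V} (hpq : p ≠ q) :
    ∃ D ⊆ C, IsCompact D ∧ Convex ℝ D ∧ D ∈ 𝓝[C] q ∧ p ∉ D := by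
  obtain ⟨f, hf⟩ := geometric_hahn_banach_point_point hpq
  obtain ⟨r, hpr, hrq⟩ := exists_between hf
  refine ⟨C ∩ {v | r ≤ f v}, inter_subset_left,
    hC.inter_right (isClosed_le continuous_const f.continuous),
    hC'.inter (convex_halfSpace_ge f.isLinear r), ?_, fun h => hpr.not_ge h.2⟩
  exact Filter.inter_mem self_mem_nhdsWithin <| mem_nhdsWithin_of_mem_nhds <|
    f.continuous.continuousAt.eventually_const_le hrq

/-- **Milman's converse** of the Krein-Milman theorem. -/
theorem extremePoints_closure_convexHull_subset {Q : Set V} (hQ : IsCompact Q)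
    (hC : IsCompact (closure (convexHull ℝ Q))) :
    (closure (convexHull ℝ Q)).extremePoints ℝ ⊆ Q := by
  intro p hp
  by_contra hpQ
  set C := closure (convexHull ℝ Q)
  have hC' : Convex ℝ C := (convex_convexHull ℝ Q).closure
  have hQC : Q ⊆ C := (subset_convexHull ℝ Q).trans subset_closure
  obtain ⟨D, -, hD, hD', hQD, hpD⟩ :
      ∃ D ⊆ C, IsCompact D ∧ Convex ℝ D ∧ Q ⊆ D ∧ p ∉ D := by
    refine hQ.induction_on (p := fun s => ∃ D ⊆ C, IsCompact D ∧ Convex ℝ D ∧ s ⊆ D ∧ p ∉ D)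
      ⟨∅, empty_subset C, isCompact_empty, convex_empty, Subset.rfl, notMem_empty p⟩ ?_ ?_ ?_
    · rintro s t hst ⟨D, hDC, hD, hD', htD, hpD⟩
      exact ⟨D, hDC, hD, hD', hst.trans htD, hpD⟩
    · rintro s t ⟨D₁, hDC₁, hD₁, hD₁', hsD, hp₁⟩ ⟨D₂, hDC₂, hD₂, hD₂', htD, hp₂⟩
      have hDC : D₁ ∪ D₂ ⊆ C := union_subset hDC₁ hDC₂
      exact ⟨convexHull ℝ (D₁ ∪ D₂), convexHull_min hDC hC',
        isCompact_convexHull_union hD₁ hD₂ hD₁' hD₂', convex_convexHull ℝ _,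
        (union_subset_union hsD htD).trans (subset_convexHull ℝ _),
        notMem_convexHull_of_mem_extremePoints hC' hp hDC (by simp [hp₁, hp₂])⟩
    · intro q hq
      obtain ⟨D, hDC, hD, hD', hDq, hpD⟩ :=
        exists_isCompact_convex_mem_nhdsWithin hC hC' (ne_of_mem_of_not_mem hq hpQ).symm
      exact ⟨D, nhdsWithin_mono q hQC hDq, D, hDC, hD, hD', Subset.rfl, hpD⟩
  exact hpD (closure_minimal (convexHull_min hQD hD') hD.isClosed hp.1)

theorem exists_mem_extremePoints_isMaxOn {s : Set V} (hs : IsCompact s) (hne : s.Nonempty)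
    (l : StrongDual ℝ V) : ∃ p ∈ s.extremePoints ℝ, IsMaxOn l s p := by
  have hface : IsExposed ℝ s (l.toExposed s) := ContinuousLinearMap.toExposed.isExposed
  obtain ⟨q, hqs, hq⟩ := hs.exists_isMaxOn hne l.continuous.continuousOn
  obtain ⟨p, hp⟩ := (hface.isCompact hs).extremePoints_nonempty ⟨q, hqs, hq⟩
  exact ⟨p, hface.isExtreme.extremePoints_subset_extremePoints hp, hp.1.2⟩

end Milman

section Norming

variable {V : Type*} [NormedAddCommGroup V] [NormedSpace ℝ V]

theorem neg_mem_extremePoints_closedBall {r : ℝ} {v : V}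
    (hv : -v ∈ (Metric.closedBall (0 : V) r).extremePoints ℝ) :
    v ∈ (Metric.closedBall (0 : V) r).extremePoints ℝ := by
  have := mem_image_of_mem (LinearEquiv.neg ℝ (M := V)) hv
  rw [image_extremePoints] at this
  simpa using this

instance weakDualLocallyConvexSpace : LocallyConvexSpace ℝ (WeakDual ℝ V) :=
  WeakBilin.locallyConvexSpace (B := topDualPairing ℝ V)

theorem closure_convexHull_eq_closedBall_of_norming {Q : Set (WeakDual ℝ V)}
    (hQ : ∀ φ ∈ Q, ‖WeakDual.toStrongDual φ‖ ≤ 1)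
    (hnorming : ∀ v r, (∀ φ ∈ Q, φ v ≤ r) → ‖v‖ ≤ r) :
    closure (convexHull ℝ Q) =
      WeakDual.toStrongDual ⁻¹' Metric.closedBall (0 : StrongDual ℝ V) 1 := by
  refine Subset.antisymm (closure_minimal (convexHull_min (fun φ hφ => by simpa using hQ φ hφ) ?_)
    (WeakDual.isClosed_closedBall 0 1)) fun φ hφ => ?_
  · exact (convex_closedBall (0 : StrongDual ℝ V) 1).linear_preimage _
  · by_contra hnot
    obtain ⟨l, r, hl, hr⟩ := geometric_hahn_banach_closed_point (convex_convexHull ℝ Q).closure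
      isClosed_closure hnot
    obtain ⟨v, rfl⟩ := LinearMap.dualEmbedding_surjective (topDualPairing ℝ V) l
    have hv : ‖v‖ ≤ r :=
      hnorming v r fun ψ hψ => (hl ψ (subset_closure (subset_convexHull ℝ Q hψ))).le
    have hφv : φ v ≤ 1 * ‖v‖ := (le_abs_self _).trans <|
      (WeakDual.toStrongDual φ).le_of_opNorm_le (mem_closedBall_zero_iff.1 hφ) v
    exact hr.not_ge (hφv.trans ((one_mul _).trans_le hv))

theorem exists_mem_extremePoints_closedBall_apply_eq_norm {Q : Set (WeakDual ℝ V)}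
    (hQ : IsCompact Q) (hQ₁ : ∀ φ ∈ Q, ‖WeakDual.toStrongDual φ‖ ≤ 1)
    (hnorming : ∀ v r, (∀ φ ∈ Q, φ v ≤ r) → ‖v‖ ≤ r) (v : V) :
    ∃ φ ∈ Q, WeakDual.toStrongDual φ ∈ (Metric.closedBall (0 : StrongDual ℝ V) 1).extremePoints ℝ ∧
      φ v = ‖v‖ := by
  have hball := closure_convexHull_eq_closedBall_of_norming hQ₁ hnorming
  have hcompact : IsCompact (closure (convexHull ℝ Q)) :=
    hball ▸ WeakDual.isCompact_closedBall 0 1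
  obtain ⟨ψ, hψ, hψv⟩ := exists_dual_vector'' ℝ v
  have hψ' : StrongDual.toWeakDual ψ ∈ closure (convexHull ℝ Q) :=
    hball ▸ mem_closedBall_zero_iff.2 hψ
  let evalAt : StrongDual ℝ (WeakDual ℝ V) := WeakBilin.eval (topDualPairing ℝ V) v
  obtain ⟨φ, hφ, hmax⟩ := exists_mem_extremePoints_isMaxOn hcompact ⟨_, hψ'⟩ evalAt
  have hφQ : φ ∈ Q := extremePoints_closure_convexHull_subset hQ hcompact hφ
  refine ⟨φ, hφQ, ?_, le_antisymm ?_ ?_⟩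
  · rw [hball] at hφ
    exact hφ
  · simpa using (le_abs_self _).trans ((WeakDual.toStrongDual φ).le_of_opNorm_le (hQ₁ φ hφQ) v)
  · exact hψv.ge.trans (hmax hψ')

end Norming

section Choquet

variable {K : Type*} [TopologicalSpace K]

theorem continuous_toWeakDual_evalOn (A : Submodule ℝ C(K, ℝ)) :
    Continuous fun x => StrongDual.toWeakDual (evalOn A x) :=
  WeakBilin.continuous_of_continuous_eval _ fun f => (f : C(K, ℝ)).continuous

variable [CompactSpace K]

theorem norm_evalOn_le (A : Submodule ℝ C(K, ℝ)) (x : K) : ‖evalOn A x‖ ≤ 1 :=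
  ContinuousLinearMap.opNorm_le_bound _ zero_le_one fun f => by
    simpa [evalOn] using (f : C(K, ℝ)).norm_coe_le_norm x

theorem exists_evalOn_mem_extremePoints_abs_eq_norm [Nonempty K] (A : Submodule ℝ C(K, ℝ))
    (f : A) :
    ∃ z, evalOn A z ∈ (Metric.closedBall (0 : StrongDual ℝ A) 1).extremePoints ℝ ∧
      |(f : C(K, ℝ)) z| = ‖f‖ := by
  set evals : Set (WeakDual ℝ A) := range fun x => StrongDual.toWeakDual (evalOn A x)
  have hevals : IsCompact evals := isCompact_range (continuous_toWeakDual_evalOn A)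
  have hball : ∀ φ ∈ evals ∪ -evals, ‖WeakDual.toStrongDual φ‖ ≤ 1 := by
    rintro φ (⟨x, rfl⟩ | ⟨x, hx⟩)
    · exact norm_evalOn_le A x
    · rw [← norm_neg (WeakDual.toStrongDual φ)]
      exact (congrArg (fun ψ => ‖WeakDual.toStrongDual ψ‖) hx.symm).trans_le (norm_evalOn_le A x)
  have hnorming : ∀ (g : A) (r : ℝ), (∀ φ ∈ evals ∪ -evals, φ g ≤ r) → ‖g‖ ≤ r := fun g r h => by
    refine (ContinuousMap.norm_le_of_nonempty (g : C(K, ℝ))).2 fun x => abs_le'.2 ⟨?_, ?_⟩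
    · exact h _ (Or.inl ⟨x, rfl⟩)
    · exact h (-StrongDual.toWeakDual (evalOn A x)) (Or.inr ⟨x, (neg_neg _).symm⟩)
  obtain ⟨φ, ⟨z, rfl⟩ | ⟨z, hz⟩, hφ, hφf⟩ :=
    exists_mem_extremePoints_closedBall_apply_eq_norm (hevals.union hevals.neg) hball hnorming f
  · exact ⟨z, hφ, (congrArg abs hφf).trans (abs_norm _)⟩
  · obtain rfl : φ = -StrongDual.toWeakDual (evalOn A z) := neg_eq_iff_eq_neg.1 hz.symm
    refine ⟨z, neg_mem_extremePoints_closedBall hφ, ?_⟩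
    rw [← abs_neg]
    exact (congrArg abs hφf).trans (abs_norm _)

variable {E : Type*} [NormedAddCommGroup E] [NormedSpace ℝ E] {H : Submodule ℝ C(K, E)}

theorem norm_le_of_forall_choquetBoundary (u : H) {c : ℝ} (hc : 0 ≤ c)
    (h : ∀ z ∈ choquetBoundary H, ‖(u : C(K, E)) z‖ ≤ c) : ‖u‖ ≤ c := by
  obtain ⟨u, hu⟩ := u
  refine (ContinuousMap.norm_le u hc).2 fun x => ?_
  have : Nonempty K := ⟨x⟩
  obtain ⟨φ, hφ, hφx⟩ := exists_dual_vector'' ℝ (u x)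
  let f : C(K, ℝ) := ⟨fun y => φ (u y), by fun_prop⟩
  have hf : f ∈ scalarSpace H :=
    Submodule.le_topologicalClosure _ (Submodule.subset_span ⟨φ, u, hu, fun _ => rfl⟩)
  obtain ⟨z, hz, hfz⟩ := exists_evalOn_mem_extremePoints_abs_eq_norm (scalarSpace H) ⟨f, hf⟩
  calc ‖u x‖ = f x := hφx.symm
    _ ≤ ‖f‖ := (le_abs_self _).trans (f.norm_coe_le_norm x)
    _ = |f z| := hfz.symm
    _ ≤ 1 * ‖u z‖ := φ.le_of_opNorm_le hφ _
    _ ≤ c := (one_mul _).trans_le (h z hz)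

end Choquet

section CopiesOfCZero

open Filter
open scoped ZeroAtInfty

variable {E : Type*} [NormedAddCommGroup E] [NormedSpace ℝ E]

section

variable {X : Type*} [NormedAddCommGroup X] [NormedSpace ℝ X]

theorem containsCopy_of_forall_le_norm (S : X →L[ℝ] E) {c : ℝ} (hc : 0 < c)
    (hS : ∀ v, c * ‖v‖ ≤ ‖S v‖) : ContainsCopy E X := by
  have hinj : Function.Injective (S : X →ₗ[ℝ] E) :=
    (injective_iff_map_eq_zero _).2 fun v hv => norm_le_zero_iff.1 <|
      nonpos_of_mul_nonpos_right ((hS v).trans_eq ((congrArg norm hv).trans norm_zero)) hc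
  refine ⟨LinearMap.range (S : X →ₗ[ℝ] E), ⟨(LinearEquiv.ofInjective _ hinj)
    |>.toContinuousLinearEquivOfBounds ‖S‖ c⁻¹ S.le_opNorm fun w => ?_⟩⟩
  obtain ⟨v, rfl⟩ := (LinearEquiv.ofInjective _ hinj).surjective w
  rw [LinearEquiv.symm_apply_apply, ← div_eq_inv_mul, le_div_iff₀' hc]
  exact hS v

theorem exists_norm_eq_one_norm_map_lt (hX : ¬ ContainsCopy E X) (S : X →L[ℝ] E) {ε : ℝ}
    (hε : 0 < ε) : ∃ v, ‖v‖ = 1 ∧ ‖S v‖ < ε := by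
  obtain ⟨v, hv⟩ : ∃ v, ‖S v‖ < ε * ‖v‖ := by
    by_contra! h
    exact hX (containsCopy_of_forall_le_norm S hε h)
  have hv0 : 0 < ‖v‖ := pos_of_mul_pos_right ((norm_nonneg _).trans_lt hv) hε.le
  refine ⟨‖v‖⁻¹ • v, by simp [norm_smul, hv0.ne'], ?_⟩
  rw [map_smul, norm_smul, norm_inv, norm_norm, ← div_eq_inv_mul, div_lt_iff₀ hv0]
  exact hv

end

theorem exists_pairwise_disjoint_infinite_subset {ι : Type*} {S : Set ι} (hS : S.Infinite) :
    ∃ P : ℕ → Set ι, (∀ p, P p ⊆ S ∧ (P p).Infinite) ∧ Pairwise (Function.onFun Disjoint P) := by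
  let g : ℕ → ℕ → ι := fun p q => hS.natEmbedding S (Nat.pair p q)
  have hg : ∀ {p q p' q'}, g p q = g p' q' → p = p' ∧ q = q' := fun h =>
    Nat.pair_eq_pair.1 ((hS.natEmbedding S).injective (Subtype.ext h))
  refine ⟨fun p => range (g p), fun p => ⟨?_, infinite_range_of_injective fun q q' h => (hg h).2⟩,
    fun p p' hpp' => disjoint_left.2 ?_⟩
  · rintro _ ⟨q, rfl⟩
    exact (hS.natEmbedding S _).2
  · rintro _ ⟨q, rfl⟩ ⟨q', h⟩
    exact hpp' (hg h).1.symm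

/-- **Rosenthal's lemma** for a nonnegative matrix with bounded row sums on an infinite set. -/
theorem exists_infinite_offDiag_sum_le {ι : Type*} {a : ι → ι → ℝ} {ε : ℝ} (hε : 0 ≤ ε) (N : ℕ)
    {S : Set ι} (hS : S.Infinite)
    (h : ∀ n ∈ S, ∀ F : Finset ι, ↑F ⊆ S → ∑ m ∈ F, a n m ≤ N * ε) :
    ∃ M ⊆ S, M.Infinite ∧
      ∀ n ∈ M, ∀ F : Finset ι, ↑F ⊆ M → n ∉ F → ∑ m ∈ F, a n m ≤ ε := by
  classical
  induction N generalizing S with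
  | zero => exact ⟨S, Subset.rfl, hS, fun n hn F hF _ => (h n hn F hF).trans (by simpa using hε)⟩
  | succ N ih =>
    obtain ⟨P, hP, hdisj⟩ := exists_pairwise_disjoint_infinite_subset hS
    by_cases hgood : ∃ p, ∀ n ∈ P p, ∀ F : Finset ι, ↑F ⊆ P p → n ∉ F → ∑ m ∈ F, a n m ≤ ε
    · obtain ⟨p, hp⟩ := hgood
      exact ⟨P p, (hP p).1, (hP p).2, hp⟩
    push Not at hgood
    -- If every block `P p` has a bad row `n p`, its off-diagonal sum over `P p` exceeds `ε`, so on
    -- `range n`, which meets `P p` in `n p` only, the row sums have dropped by `ε`.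
    choose n hn F hF hnF hsum using hgood
    have hinj : ∀ {p p'}, n p' ∈ P p → p = p' := fun {p p'} h => by
      by_contra hne
      exact disjoint_left.1 (hdisj hne) h (hn p')
    have hnS : range n ⊆ S := range_subset_iff.2 fun p => (hP p).1 (hn p)
    have hrow : ∀ i ∈ range n, ∀ G : Finset ι, ↑G ⊆ range n → ∑ m ∈ G, a i m ≤ N * ε := by
      rintro _ ⟨p, rfl⟩ G hG
      have hGF : Disjoint G (F p) := Finset.disjoint_left.2 fun m hmG hmF => by
        obtain ⟨p', rfl⟩ := hG hmG
        obtain rfl := hinj (hF p hmF)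
        exact hnF p hmF
      have htotal := h (n p) (hnS ⟨p, rfl⟩) (G ∪ F p) (by
        rw [Finset.coe_union]
        exact union_subset (hG.trans hnS) ((hF p).trans (hP p).1))
      rw [Finset.sum_union hGF, Nat.cast_succ, add_one_mul] at htotal
      linarith [hsum p]
    obtain ⟨M, hM, hM'⟩ :=
      ih (infinite_range_of_injective fun p p' h => hinj (mem_of_eq_of_mem h.symm (hn p))) hrow
    exact ⟨M, hM.trans hnS, hM'⟩

theorem abs_apply_le_norm_c₀ (c : C₀(ℕ, ℝ)) (n : ℕ) : |c n| ≤ ‖c‖ := by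
  rw [← ZeroAtInftyContinuousMap.norm_toBCF_eq_norm]
  exact c.toBCF.norm_coe_le_norm n

/-- The series `∑ x i` is weakly unconditionally Cauchy, with `C` bounding the sums
`∑ |φ (x i)|` for `φ` in the unit ball of the dual. -/
def WeaklyUnconditionallyCauchyWith {ι : Type*} (C : ℝ) (x : ι → E) : Prop :=
  ∀ φ : StrongDual ℝ E, ‖φ‖ ≤ 1 → ∀ F : Finset ι, ∑ i ∈ F, |φ (x i)| ≤ C

namespace WeaklyUnconditionallyCauchyWith

section

variable {ι : Type*} {x : ι → E} {C : ℝ}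

theorem of_norm_sum_smul_le
    (h : ∀ F : Finset ι, ∀ s : ι → ℝ, (∀ i, |s i| ≤ 1) → ‖∑ i ∈ F, s i • x i‖ ≤ C) :
    WeaklyUnconditionallyCauchyWith C x := fun φ hφ F => by
  let s : ι → ℝ := fun i => SignType.sign (φ (x i))
  have hs : ∀ i, |s i| ≤ 1 := fun i => by
    rcases SignType.trichotomy (SignType.sign (φ (x i))) with h | h | h <;> simp [s, h]
  calc ∑ i ∈ F, |φ (x i)| = φ (∑ i ∈ F, s i • x i) := by
        simp only [map_sum, map_smul, smul_eq_mul, s, sign_mul_self]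
    _ ≤ 1 * ‖∑ i ∈ F, s i • x i‖ := (le_abs_self _).trans (φ.le_of_opNorm_le hφ _)
    _ ≤ C := (one_mul _).trans_le (h F s hs)

theorem comp_injective (h : WeaklyUnconditionallyCauchyWith C x) {κ : Type*} {σ : κ → ι}
    (hσ : σ.Injective) : WeaklyUnconditionallyCauchyWith C (x ∘ σ) := fun φ hφ F => by
  simpa using h φ hφ (F.map ⟨σ, hσ⟩)

theorem nonneg (h : WeaklyUnconditionallyCauchyWith C x) : 0 ≤ C := by
  simpa using h 0 (by simp) ∅

theorem norm_sum_smul_le (h : WeaklyUnconditionallyCauchyWith C x) {c : ι → ℝ} {r : ℝ}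
    (hr : 0 ≤ r) {F : Finset ι} (hc : ∀ i ∈ F, |c i| ≤ r) : ‖∑ i ∈ F, c i • x i‖ ≤ r * C := by
  obtain ⟨φ, hφ, hφx⟩ := exists_dual_vector'' ℝ (∑ i ∈ F, c i • x i)
  calc ‖∑ i ∈ F, c i • x i‖ = ∑ i ∈ F, c i * φ (x i) :=
        hφx.symm.trans (by simp [map_sum])
    _ ≤ ∑ i ∈ F, r * |φ (x i)| := Finset.sum_le_sum fun i hi => by
        refine (le_abs_self _).trans ?_
        rw [abs_mul]
        gcongr
        exact hc i hi
    _ = r * ∑ i ∈ F, |φ (x i)| := by rw [Finset.mul_sum]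
    _ ≤ r * C := by gcongr; exact h φ hφ F

theorem summable_smul [CompleteSpace E] (h : WeaklyUnconditionallyCauchyWith C x) {c : ι → ℝ}
    (hc : Tendsto c cofinite (𝓝 0)) : Summable fun i => c i • x i := by
  rw [summable_iff_vanishing_norm]
  intro ε hε
  have hC := h.nonneg
  have hsmall : ∀ᶠ i in cofinite, |c i| < ε / (C + 1) := by
    simpa using hc.eventually (Metric.ball_mem_nhds (0 : ℝ) (show 0 < ε / (C + 1) by positivity))
  rw [eventually_cofinite] at hsmall
  refine ⟨hsmall.toFinset, fun F hF => ?_⟩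
  calc ‖∑ i ∈ F, c i • x i‖ ≤ ε / (C + 1) * C := h.norm_sum_smul_le (by positivity) fun i hi => by
        by_contra hlt
        exact Finset.disjoint_left.1 hF hi (hsmall.mem_toFinset.2 fun h' => hlt h'.le)
    _ < ε := by
        rw [div_mul_eq_mul_div, div_lt_iff₀ (by positivity)]
        gcongr
        linarith

end

variable [CompleteSpace E] {x : ℕ → E} {C : ℝ}

theorem summable_c₀_smul (h : WeaklyUnconditionallyCauchyWith C x) (c : C₀(ℕ, ℝ)) :
    Summable fun n => c n • x n :=
  h.summable_smul (by simpa [Nat.cofinite_eq_atTop] using c.zero_at_infty')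

/-- The operator `c ↦ ∑ c n • x n` on `c₀` of a weakly unconditionally Cauchy series. -/
noncomputable def c₀Operator (h : WeaklyUnconditionallyCauchyWith C x) : C₀(ℕ, ℝ) →L[ℝ] E :=
  LinearMap.mkContinuous
    { toFun := fun c => ∑' n, c n • x n
      map_add' := fun c d => by
        simpa only [ZeroAtInftyContinuousMap.add_apply, add_smul] using
          (h.summable_c₀_smul c).tsum_add (h.summable_c₀_smul d)
      map_smul' := fun r c => by
        simpa only [ZeroAtInftyContinuousMap.smul_apply, smul_assoc, RingHom.id_apply] using
          (h.summable_c₀_smul c).tsum_const_smul r }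
    C fun c => le_of_tendsto (h.summable_c₀_smul c).hasSum.norm <| Eventually.of_forall fun F =>
      (h.norm_sum_smul_le (norm_nonneg c) fun n _ => abs_apply_le_norm_c₀ c n).trans_eq
        (mul_comm _ _)

theorem hasSum_c₀Operator (h : WeaklyUnconditionallyCauchyWith C x) (c : C₀(ℕ, ℝ)) :
    HasSum (fun n => c n • x n) (h.c₀Operator c) :=
  (h.summable_c₀_smul c).hasSum

theorem abs_apply_c₀Operator_sub_le (h : WeaklyUnconditionallyCauchyWith C x)
    {φ : StrongDual ℝ E} {n : ℕ} {η : ℝ}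
    (hφ : ∀ F : Finset ℕ, n ∉ F → ∑ m ∈ F, |φ (x m)| ≤ η) (c : C₀(ℕ, ℝ)) :
    |φ (h.c₀Operator c) - c n * φ (x n)| ≤ ‖c‖ * η := by
  have hsum := hasSum_ite_sub_hasSum ((h.hasSum_c₀Operator c).mapL φ) n
  simp only [map_smul, smul_eq_mul] at hsum
  refine le_of_tendsto hsum.norm <| Eventually.of_forall fun F => ?_
  calc ‖∑ m ∈ F, if m = n then 0 else c m * φ (x m)‖
      = ‖∑ m ∈ F.erase n, c m * φ (x m)‖ := by
        simp only [← Finset.filter_ne', Finset.sum_filter, ite_not]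
    _ ≤ ∑ m ∈ F.erase n, ‖c‖ * |φ (x m)| := norm_sum_le_of_le _ fun m _ => by
        rw [norm_mul]
        exact mul_le_mul_of_nonneg_right (abs_apply_le_norm_c₀ c m) (norm_nonneg _)
    _ = ‖c‖ * ∑ m ∈ F.erase n, |φ (x m)| := by rw [Finset.mul_sum]
    _ ≤ ‖c‖ * η := by
        gcongr
        exact hφ _ (Finset.notMem_erase n F)

theorem containsCopy_c₀ (h : WeaklyUnconditionallyCauchyWith C x) {δ : ℝ} (hδ : 0 < δ)
    {φ : ℕ → StrongDual ℝ E} (hφ : ∀ n, ‖φ n‖ ≤ 1) (hdiag : ∀ n, δ ≤ φ n (x n))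
    (hoff : ∀ n, ∀ F : Finset ℕ, n ∉ F → ∑ m ∈ F, |φ n (x m)| ≤ δ / 2) :
    ContainsCopy E C₀(ℕ, ℝ) := by
  refine containsCopy_of_forall_le_norm h.c₀Operator (half_pos hδ) fun c => ?_
  have hcoord : ∀ n, |c n| * δ ≤ ‖h.c₀Operator c‖ + ‖c‖ * (δ / 2) := fun n => calc
    |c n| * δ ≤ |c n * φ n (x n)| := by
        rw [abs_mul]
        gcongr
        exact (hdiag n).trans (le_abs_self _)
    _ ≤ |φ n (h.c₀Operator c)| + |φ n (h.c₀Operator c) - c n * φ n (x n)| :=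
        norm_le_norm_add_norm_sub (φ n (h.c₀Operator c)) _
    _ ≤ 1 * ‖h.c₀Operator c‖ + ‖c‖ * (δ / 2) :=
        add_le_add ((φ n).le_of_opNorm_le (hφ n) _) (h.abs_apply_c₀Operator_sub_le (hoff n) c)
    _ = ‖h.c₀Operator c‖ + ‖c‖ * (δ / 2) := by rw [one_mul]
  have hnorm : ‖c‖ ≤ (‖h.c₀Operator c‖ + ‖c‖ * (δ / 2)) / δ := by
    rw [← ZeroAtInftyContinuousMap.norm_toBCF_eq_norm]
    refine (BoundedContinuousFunction.norm_le (by positivity)).2 fun n => ?_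
    rw [le_div_iff₀ hδ]
    exact hcoord n
  rw [le_div_iff₀ hδ] at hnorm
  linarith

end WeaklyUnconditionallyCauchyWith

/-- **Bessaga-Pełczyński**: in a Banach space without copies of `c₀`, the terms of a weakly
unconditionally Cauchy series tend to `0`. -/
theorem WeaklyUnconditionallyCauchyWith.tendsto_zero [CompleteSpace E]
    (hE : ¬ ContainsCopy E C₀(ℕ, ℝ)) {x : ℕ → E} {C : ℝ}
    (h : WeaklyUnconditionallyCauchyWith C x) : Tendsto x atTop (𝓝 0) := by
  by_contra hx
  obtain ⟨δ, hδ, hS⟩ : ∃ δ > 0, {n | δ ≤ ‖x n‖}.Infinite := by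
    by_contra! hfinite
    refine hx (tendsto_zero_iff_norm_tendsto_zero.2 ?_)
    rw [← Nat.cofinite_eq_atTop, Metric.tendsto_nhds]
    intro δ hδ
    rw [eventually_cofinite]
    simpa using hfinite δ hδ
  choose φ hφ hφx using fun n => exists_dual_vector'' ℝ (x n)
  obtain ⟨N, hN⟩ := exists_nat_ge (C / (δ / 2))
  rw [div_le_iff₀ (half_pos hδ)] at hN
  obtain ⟨M, hMS, hM, hoff⟩ := exists_infinite_offDiag_sum_le (a := fun n m => |φ n (x m)|)
    (half_pos hδ).le N hS fun n _ F _ => (h (φ n) (hφ n) F).trans hN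
  let σ : ℕ ↪ ℕ := (hM.natEmbedding M).trans (Function.Embedding.subtype _)
  have hσ : ∀ n, σ n ∈ M := fun n => (hM.natEmbedding M n).2
  refine hE ((h.comp_injective σ.injective).containsCopy_c₀ hδ (φ := fun n => φ (σ n))
    (fun n => hφ _) (fun n => ?_) fun n F hF => ?_)
  · exact (hMS (hσ n)).trans_eq (hφx _).symm
  · simpa using hoff (σ n) (hσ n) (F.map σ) (by
      rw [Finset.coe_map]
      rintro _ ⟨m, -, rfl⟩
      exact hσ m) (by simpa using hF)

end CopiesOfCZero

section PeakFunctions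

open Filter
open scoped ZeroAtInfty

theorem exists_seq_pairwise_disjoint_isOpen {K : Type*} [TopologicalSpace K] [CompactSpace K]
    [T2Space K] {S : Set K} (hS : S.Infinite) :
    ∃ (x : ℕ → K) (V : ℕ → Set K), (∀ n, x n ∈ S ∧ IsOpen (V n) ∧ x n ∈ V n) ∧
      Pairwise (Function.onFun Disjoint V) := by
  obtain ⟨p, hp⟩ := hS.exists_accPt_principal
  rw [accPt_iff_nhds] at hp
  let good : K × Set K → Prop := fun q => q.1 ∈ S ∧ IsOpen q.2 ∧ q.1 ∈ q.2 ∧ p ∉ closure q.2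
  have hnext : ∀ s : Finset (K × Set K), (∀ q ∈ s, good q) →
      ∃ q', good q' ∧ ∀ q ∈ s, Disjoint q.2 q'.2 := fun s hs => by
    have hopen : IsOpen (⋂ q ∈ s, (closure q.2)ᶜ) :=
      isOpen_biInter_finset fun q _ => isClosed_closure.isOpen_compl
    obtain ⟨x, ⟨hxN, hxS⟩, hxp⟩ := hp _ (hopen.mem_nhds (mem_iInter₂.2 fun q hq => (hs q hq).2.2.2))
    obtain ⟨A, A', hA, hA', hxA, hpA', hAA'⟩ := t2_separation hxp
    refine ⟨(x, (⋂ q ∈ s, (closure q.2)ᶜ) ∩ A), ⟨hxS, hopen.inter hA, ⟨hxN, hxA⟩, fun hpc => ?_⟩,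
      fun q hq => disjoint_left.2 fun z hzq hz => ?_⟩
    · exact disjoint_left.1 (hAA'.closure_left hA') (closure_mono inter_subset_right hpc) hpA'
    · exact mem_iInter₂.1 hz.1 q hq (subset_closure hzq)
  obtain ⟨g, hg, hdisj⟩ := exists_seq_of_forall_finset_exists good _ hnext
  exact ⟨fun n => (g n).1, fun n => (g n).2, fun n => ⟨(hg n).1, (hg n).2.1, (hg n).2.2.1⟩,
    (pairwise_disjoint_on _).2 hdisj⟩

theorem exists_norm_apply_eq_norm_pi {ι : Type*} [Fintype ι] [Nonempty ι]
    {E : Type*} [SeminormedAddCommGroup E] (v : ι → E) :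
    ∃ i, ‖v i‖ = ‖v‖ := by
  obtain ⟨i, hi⟩ := Finite.exists_max fun i => ‖v i‖
  exact ⟨i, le_antisymm (norm_le_pi_norm v i) (pi_norm_le_iff_of_nonneg (norm_nonneg _) |>.2 hi)⟩

variable {K E Y : Type*} [TopologicalSpace K] [CompactSpace K]
  [NormedAddCommGroup E] [NormedSpace ℝ E] [NormedAddCommGroup Y] [NormedSpace ℝ Y]
  {H : Submodule ℝ C(K, E)}

/-- The operator `e ↦ f ⊗ e` into `H`. -/
noncomputable def tensorMem {f : C(K, ℝ)} (hf : f ∈ tensorMultipliers H) : E →L[ℝ] H :=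
  LinearMap.mkContinuous
    { toFun := fun e => ⟨tensorVec f e, hf.2 e⟩
      map_add' := fun e e' => by
        ext x
        exact smul_add (f x) e e'
      map_smul' := fun r e => by
        ext x
        exact smul_comm (f x) r e }
    ‖f‖ fun e => (ContinuousMap.norm_le _ (by positivity)).2 fun x =>
      (norm_smul_le _ _).trans <| by gcongr; exact f.norm_coe_le_norm x

theorem tensorMem_apply {f : C(K, ℝ)} (hf : f ∈ tensorMultipliers H) (e : E) (x : K) :
    (tensorMem hf e : C(K, E)) x = f x • e := rfl

/-- `f` is a member of `𝒜^E` with values in `[0, 1]` which, up to the tolerance `δ`, peaks at `x`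
and vanishes on the part of the Choquet boundary that lies outside `U`. -/
structure IsPeakFunction (H : Submodule ℝ C(K, E)) (U : Set K) (x : K) (δ : ℝ) (f : C(K, ℝ)) :
    Prop where
  mem : f ∈ tensorMultipliers H
  nonneg : ∀ z, 0 ≤ f z
  le_one : ∀ z, f z ≤ 1
  one_sub_lt : 1 - δ < f x
  lt_of_notMem : ∀ z ∈ choquetBoundary H, z ∉ U → f z < δ

theorem exists_isPeakFunction {x : K} (hx : x ∈ weakPeakPoints H) {U : Set K} (hU : U ∈ 𝓝 x)
    {δ : ℝ} (hδ : 0 < δ) (hδ₁ : δ < 1) : ∃ f, IsPeakFunction H U x δ f := by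
  obtain ⟨f, hf, hf01, hfx, hfU⟩ := hx U hU δ hδ hδ₁
  exact ⟨f, hf, fun z => (hf01 z).1, fun z => (hf01 z).2, hfx, fun z hz hzU => hfU z ⟨hz, hzU⟩⟩

namespace IsPeakFunction

variable {U : Set K} {x : K} {δ : ℝ} {f : C(K, ℝ)}

theorem tolerance_pos (hf : IsPeakFunction H U x δ f) : 0 < δ := by
  linarith [hf.one_sub_lt, hf.le_one x]

theorem mono (hf : IsPeakFunction H U x δ f) {U' : Set K} {δ' : ℝ} (hU : U ⊆ U') (hδ : δ ≤ δ') :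
    IsPeakFunction H U' x δ' f where
  mem := hf.mem
  nonneg := hf.nonneg
  le_one := hf.le_one
  one_sub_lt := by linarith [hf.one_sub_lt]
  lt_of_notMem z hz hzU := (hf.lt_of_notMem z hz fun h => hzU (hU h)).trans_le hδ

theorem norm_tensorMem_apply_sub (hf : IsPeakFunction H U x δ f) (e : E) :
    ‖(tensorMem hf.mem e : C(K, E)) x - e‖ = (1 - f x) * ‖e‖ := by
  rw [tensorMem_apply, norm_sub_rev, ← Real.norm_of_nonneg (sub_nonneg.2 (hf.le_one x)),
    ← norm_smul, sub_smul, one_smul]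

theorem norm_tensorMem_apply_sub_lt (hf : IsPeakFunction H U x δ f) {e : E} (he : ‖e‖ = 1) :
    ‖(tensorMem hf.mem e : C(K, E)) x - e‖ < δ := by
  rw [hf.norm_tensorMem_apply_sub, he]
  linarith [hf.one_sub_lt]

theorem norm_tensorMem_le (hf : IsPeakFunction H U x δ f) (e : E) :
    ‖tensorMem hf.mem e‖ ≤ ‖e‖ := by
  refine norm_le_of_forall_choquetBoundary _ (norm_nonneg e) fun z _ => ?_
  rw [tensorMem_apply, norm_smul, Real.norm_of_nonneg (hf.nonneg z)]
  exact mul_le_of_le_one_left (norm_nonneg e) (hf.le_one z)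

end IsPeakFunction

theorem weakPeakPoints_subset_closure_choquetBoundary (H : Submodule ℝ C(K, E)) :
    weakPeakPoints H ⊆ closure (choquetBoundary H) := by
  intro x hx
  by_contra hcl
  obtain ⟨f, hf⟩ := exists_isPeakFunction hx (isClosed_closure.isOpen_compl.mem_nhds hcl)
    (by norm_num : (0 : ℝ) < 1 / 2) (by norm_num)
  have : Nonempty K := ⟨x⟩
  obtain ⟨z, hz, hfz⟩ :=
    exists_evalOn_mem_extremePoints_abs_eq_norm (scalarSpace H) ⟨f, hf.mem.1⟩
  have hfx : f x ≤ f z := calc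
    f x ≤ ‖f‖ := (le_abs_self _).trans (f.norm_coe_le_norm x)
    _ = f z := hfz.symm.trans (abs_of_nonneg (hf.nonneg z))
  linarith [hf.one_sub_lt, hf.lt_of_notMem z hz fun h => h (subset_closure hz)]

section DisjointPeaks

variable {ι : Type*} {V : ι → Set K} {x : ι → K} {η : ι → ℝ} {f : ι → C(K, ℝ)}

theorem sum_peakFunction_apply_le (hf : ∀ i, IsPeakFunction H (V i) (x i) (η i) (f i))
    (hV : Pairwise (Function.onFun Disjoint V)) (F : Finset ι) {z : K}
    (hz : z ∈ choquetBoundary H) : ∑ i ∈ F, f i z ≤ 1 + ∑ i ∈ F, η i := by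
  classical
  by_cases h : ∃ m ∈ F, z ∈ V m
  · obtain ⟨m, hmF, hm⟩ := h
    rw [← Finset.add_sum_erase F _ hmF, ← Finset.add_sum_erase F η hmF]
    have hrest : ∑ i ∈ F.erase m, f i z ≤ ∑ i ∈ F.erase m, η i := Finset.sum_le_sum fun i hi =>
      ((hf i).lt_of_notMem z hz
        fun hzi => disjoint_left.1 (hV (Finset.ne_of_mem_erase hi)) hzi hm).le
    linarith [(hf m).le_one z, (hf m).tolerance_pos]
  · push Not at h
    have := Finset.sum_le_sum fun i hi => ((hf i).lt_of_notMem z hz (h i hi)).le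
    linarith

theorem norm_sum_tensorMem_le (hf : ∀ i, IsPeakFunction H (V i) (x i) (η i) (f i))
    (hV : Pairwise (Function.onFun Disjoint V)) (F : Finset ι) {c : ι → E} {r : ℝ} (hr : 0 ≤ r)
    (hc : ∀ i ∈ F, ‖c i‖ ≤ r) :
    ‖∑ i ∈ F, tensorMem (hf i).mem (c i)‖ ≤ (1 + ∑ i ∈ F, η i) * r := by
  have hη : 0 ≤ ∑ i ∈ F, η i := Finset.sum_nonneg fun i _ => (hf i).tolerance_pos.le
  refine norm_le_of_forall_choquetBoundary _ (by positivity) fun z hz => ?_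
  calc ‖((∑ i ∈ F, tensorMem (hf i).mem (c i) : H) : C(K, E)) z‖ = ‖∑ i ∈ F, f i z • c i‖ := by
        simp [tensorMem_apply]
    _ ≤ ∑ i ∈ F, f i z * r := norm_sum_le_of_le _ fun i hi => by
        rw [norm_smul, Real.norm_of_nonneg ((hf i).nonneg z)]
        exact mul_le_mul_of_nonneg_left (hc i hi) ((hf i).nonneg z)
    _ = (∑ i ∈ F, f i z) * r := by rw [Finset.sum_mul]
    _ ≤ (1 + ∑ i ∈ F, η i) * r := by
        gcongr
        exact sum_peakFunction_apply_le hf hV F hz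

theorem peakFunction_apply_le_of_ne (hf : ∀ i, IsPeakFunction H (V i) (x i) (η i) (f i))
    (hV : Pairwise (Function.onFun Disjoint V)) {i j : ι} (hij : i ≠ j) (hVi : V i ∈ 𝓝 (x i))
    (hxi : x i ∈ weakPeakPoints H) : f j (x i) ≤ η j := by
  by_contra! hlt
  obtain ⟨z, ⟨hz, hzV⟩, hzC⟩ := mem_closure_iff_nhds.1
    (weakPeakPoints_subset_closure_choquetBoundary H hxi) _
    (inter_mem ((f j).continuous.continuousAt.eventually_const_lt hlt) hVi)
  exact lt_asymm hz ((hf j).lt_of_notMem z hzC fun hzj => disjoint_left.1 (hV hij) hzV hzj)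

theorem norm_sum_tensorMem_apply_sub_le (hf : ∀ i, IsPeakFunction H (V i) (x i) (η i) (f i))
    (hV : Pairwise (Function.onFun Disjoint V)) {F : Finset ι} {i : ι} (hi : i ∈ F)
    (hVi : V i ∈ 𝓝 (x i)) (hxi : x i ∈ weakPeakPoints H) {c : ι → E} {r : ℝ}
    (hc : ∀ j ∈ F, ‖c j‖ ≤ r) :
    ‖((∑ j ∈ F, tensorMem (hf j).mem (c j) : H) : C(K, E)) (x i) - c i‖ ≤ (∑ j ∈ F, η j) * r := by
  classical
  have hsplit : ((∑ j ∈ F, tensorMem (hf j).mem (c j) : H) : C(K, E)) (x i) - c i =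
      ((tensorMem (hf i).mem (c i) : C(K, E)) (x i) - c i) +
        ∑ j ∈ F.erase i, f j (x i) • c j := by
    rw [← Finset.add_sum_erase F _ hi]
    simp only [Submodule.coe_add, Submodule.coe_sum, ContinuousMap.add_apply,
      ContinuousMap.sum_apply, tensorMem_apply]
    abel
  rw [hsplit, ← Finset.add_sum_erase F η hi, add_mul, Finset.sum_mul]
  refine norm_add_le_of_le ?_ (norm_sum_le_of_le _ fun j hj => ?_)
  · rw [(hf i).norm_tensorMem_apply_sub]
    exact mul_le_mul (by linarith [(hf i).one_sub_lt]) (hc i hi) (norm_nonneg _)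
      (hf i).tolerance_pos.le
  · rw [norm_smul, Real.norm_of_nonneg ((hf j).nonneg _)]
    exact mul_le_mul
      (peakFunction_apply_le_of_ne hf hV (Finset.ne_of_mem_erase hj).symm hVi hxi)
      (hc j (Finset.mem_of_mem_erase hj)) (norm_nonneg _) (hf j).tolerance_pos.le

end DisjointPeaks

theorem tendsto_map_tensorMem_zero [CompleteSpace Y]
    (hY : ¬ ContainsCopy Y C₀(ℕ, ℝ)) (R : H →L[ℝ] Y)
    {V : ℕ → Set K} {x : ℕ → K} {η : ℕ → ℝ} {f : ℕ → C(K, ℝ)}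
    (hf : ∀ n, IsPeakFunction H (V n) (x n) (η n) (f n))
    (hV : Pairwise (Function.onFun Disjoint V)) (hη : Summable η) (e : E) :
    Tendsto (fun n => R (tensorMem (hf n).mem e)) atTop (𝓝 0) := by
  refine WeaklyUnconditionallyCauchyWith.tendsto_zero hY
    (C := ‖R‖ * ((1 + ∑' n, η n) * ‖e‖)) (.of_norm_sum_smul_le fun F s hs => ?_)
  calc ‖∑ n ∈ F, s n • R (tensorMem (hf n).mem e)‖
      = ‖R (∑ n ∈ F, tensorMem (hf n).mem (s n • e))‖ := by simp only [map_sum, map_smul]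
    _ ≤ ‖R‖ * ((1 + ∑ n ∈ F, η n) * ‖e‖) := R.le_opNorm_of_le <|
        norm_sum_tensorMem_le hf hV F (norm_nonneg e) fun n _ =>
          (norm_smul_le _ _).trans (mul_le_of_le_one_left (norm_nonneg e) (hs n))
    _ ≤ ‖R‖ * ((1 + ∑' n, η n) * ‖e‖) := by
        gcongr
        exact hη.sum_le_tsum F fun n _ => (hf n).tolerance_pos.le

theorem exists_isPeakFunction_forall_norm_map_lt [T2Space K] [CompleteSpace Y]
    (hY : ¬ ContainsCopy Y C₀(ℕ, ℝ)) {κ : Type*} [Finite κ]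
    (R : κ → H →L[ℝ] Y) {S U : Set K} (hS : S.Infinite) (hSW : S ⊆ weakPeakPoints H)
    (hU : IsOpen U) (hSU : S ⊆ U) (e : E) {δ ε : ℝ} (hδ : 0 < δ) (hδ₁ : δ < 1) (hε : 0 < ε) :
    ∃ x ∈ S, ∃ (f : C(K, ℝ)) (hf : IsPeakFunction H U x δ f),
      ∀ q, ‖R q (tensorMem hf.mem e)‖ < ε := by
  obtain ⟨x, V, hxV, hV⟩ := exists_seq_pairwise_disjoint_isOpen hS
  let η : ℕ → ℝ := fun n => δ * (1 / 2) ^ n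
  have hηδ : ∀ n, η n ≤ δ := fun n =>
    mul_le_of_le_one_right hδ.le (pow_le_one₀ (by norm_num) (by norm_num))
  choose f hf using fun n => exists_isPeakFunction (hSW (hxV n).1)
    (inter_mem ((hxV n).2.1.mem_nhds (hxV n).2.2) (hU.mem_nhds (hSU (hxV n).1)))
    (by positivity : 0 < η n) ((hηδ n).trans_lt hδ₁)
  have hsmall : ∀ᶠ n in atTop, ∀ q, ‖R q (tensorMem (hf n).mem e)‖ < ε := by
    refine eventually_all.2 fun q => ?_
    have htendsto := tendsto_map_tensorMem_zero hY (R q) hf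
      (fun m n hmn => (hV hmn).mono inter_subset_left inter_subset_left)
      (summable_geometric_two.mul_left δ) e
    exact htendsto.norm.eventually_lt_const (norm_zero.trans_lt hε)
  obtain ⟨n, hn⟩ := hsmall.exists
  exact ⟨x n, (hxV n).1, f n, (hf n).mono inter_subset_right (hηδ n), hn⟩

theorem exists_almost_attaining_norm_map_lt [T2Space K] {ι : Type*} [Fintype ι]
    (hY : ¬ ContainsCopy Y (ι → E)) (R : H →L[ℝ] Y) {x : ι → K} (hx : x.Injective)
    (hxH : ∀ i, x i ∈ weakPeakPoints H) {δ ε : ℝ} (hδ : 0 < δ) (hδ₁ : δ < 1) (hε : 0 < ε) :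
    ∃ e : E, ‖e‖ = 1 ∧ ∃ (i : ι) (u : H), ‖(u : C(K, E)) (x i) - e‖ < δ ∧ ‖u‖ ≤ 1 + δ ∧
      ‖R u‖ < ε := by
  obtain ⟨V, hV, hVdisj⟩ := (finite_range x).t2_separation
  have hVx : Pairwise (Function.onFun Disjoint (V ∘ x)) := fun i j hij =>
    hVdisj (mem_range_self i) (mem_range_self j) (hx.ne hij)
  have hVnhds : ∀ i, V (x i) ∈ 𝓝 (x i) := fun i => (hV (x i)).2.mem_nhds (hV (x i)).1
  let η := δ / (Fintype.card ι + 1)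
  have hη : 0 < η := by positivity
  have hsum : ∑ _i : ι, η < δ := by
    rw [Finset.sum_const, Finset.card_univ, nsmul_eq_mul, ← mul_div_assoc,
      div_lt_iff₀ (by positivity)]
    linarith
  choose f hf using fun i => exists_isPeakFunction (hxH i) (hVnhds i) hη
    ((div_le_self hδ.le (by simp)).trans_lt hδ₁)
  let T : (ι → E) →L[ℝ] H := ∑ i, (tensorMem (hf i).mem).comp (.proj i)
  have hT : ∀ v, T v = ∑ i, tensorMem (hf i).mem (v i) := fun v => by simp [T]
  obtain ⟨v, hv, hRv⟩ := exists_norm_eq_one_norm_map_lt hY (R.comp T) hε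
  have hcoord : ∀ i ∈ Finset.univ, ‖v i‖ ≤ 1 := fun i _ => (norm_le_pi_norm v i).trans hv.le
  have : Nonempty ι := by
    by_contra hempty
    rw [not_nonempty_iff] at hempty
    simp [Subsingleton.elim v 0] at hv
  obtain ⟨i, hi⟩ := exists_norm_apply_eq_norm_pi v
  refine ⟨v i, hi.trans hv, i, T v, ?_, ?_, hRv⟩
  · rw [hT]
    exact (norm_sum_tensorMem_apply_sub_le hf hVx (Finset.mem_univ i) (hVnhds i) (hxH i)
      hcoord).trans_lt ((mul_one _).trans_lt hsum)
  · rw [hT]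
    exact (norm_sum_tensorMem_le hf hVx _ zero_le_one hcoord).trans (by linarith)

end PeakFunctions

section PeakChains

open Filter CantorBendixson
open scoped ZeroAtInfty

section Counting

variable {X Y : Type*} [TopologicalSpace X] [NormedAddCommGroup Y]

theorem iteratedDerivedSet_natCast_succ (S : Set X) (r : ℕ) :
    iteratedDerivedSet S ((r + 1 : ℕ) : Ordinal) =
      derivedSet (iteratedDerivedSet S (r : Ordinal)) ∩ iteratedDerivedSet S (r : Ordinal) := by
  rw [Nat.cast_succ, iteratedDerivedSet_succ, relDerivedSet_apply]

theorem iteratedDerivedSet_subset (S : Set X) (a : Ordinal) : iteratedDerivedSet S a ⊆ S := by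
  simpa only [iteratedDerivedSet_zero] using
    iteratedDerivedSet_antitone S (zero_le : (0 : Ordinal) ≤ a)

open scoped Classical in
/-- The number of indices `i < n` for which `g i` has norm at least `δ` at `y`. -/
noncomputable def largeCount (δ : ℝ) (n : ℕ) (g : ℕ → C(X, Y)) (y : X) : ℕ :=
  Nat.count (fun i => δ ≤ ‖g i y‖) n

/-- The points `y` at which a further large function could violate the bound
`largeCount δ n g y + j ≤ k` for some `j` with `y ∈ B^(j)`. -/
def saturatedSet (B : Set X) (k : ℕ) (δ : ℝ) (n : ℕ) (g : ℕ → C(X, Y)) : Set X :=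
  {y | ∃ j ≤ k, y ∈ iteratedDerivedSet B (j : Ordinal) ∧ k ≤ largeCount δ n g y + j}

variable {B Ω : Set X} {k n : ℕ} {δ : ℝ} {g : ℕ → C(X, Y)}

theorem eventually_largeCount_le (δ : ℝ) (n : ℕ) (g : ℕ → C(X, Y)) (y : X) :
    ∀ᶠ z in 𝓝 y, largeCount δ n g z ≤ largeCount δ n g y := by
  classical
  have hstay : ∀ᶠ z in 𝓝 y, ∀ i ∈ Finset.range n, ‖g i y‖ < δ → ‖g i z‖ < δ :=
    (eventually_all_finset _).2 fun i _ => eventually_imp_distrib_left.2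
      (g i).continuous.norm.continuousAt.eventually_lt_const
  filter_upwards [hstay] with z hz
  refine Nat.count_mono_left fun i hi hzi => ?_
  contrapose! hzi
  exact hz i (Finset.mem_range.2 hi) hzi

theorem largeCount_congr {g' : ℕ → C(X, Y)} (h : ∀ i < n, g i = g' i) (y : X) :
    largeCount δ n g y = largeCount δ n g' y := by
  classical
  exact le_antisymm (Nat.count_mono_left fun i hi hle => h i hi ▸ hle)
    (Nat.count_mono_left fun i hi hle => h i hi ▸ hle)

theorem exists_lt_norm_lt_of_largeCount_lt {m : ℕ} {y : X} (hmn : m ≤ n)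
    (h : largeCount δ n g y < m) : ∃ j < m, ‖g j y‖ < δ := by
  classical
  by_contra! hall
  exact h.not_ge ((Nat.count_iff_forall.2 hall).ge.trans (Nat.count_monotone _ hmn))

theorem sum_le_largeCount_mul_add {y : X} {c : ℕ → ℝ} {M m : ℝ}
    (hM : ∀ i < n, δ ≤ ‖g i y‖ → c i ≤ M) (hm : ∀ i < n, ‖g i y‖ < δ → c i ≤ m) (hm₀ : 0 ≤ m) :
    ∑ i ∈ Finset.range n, c i ≤ largeCount δ n g y * M + n * m := by
  classical
  calc ∑ i ∈ Finset.range n, c i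
      ≤ ∑ i ∈ Finset.range n, ((if δ ≤ ‖g i y‖ then M else 0) + m) :=
        Finset.sum_le_sum fun i hi => by
          split_ifs with h
          · exact le_add_of_le_of_nonneg (hM i (Finset.mem_range.1 hi) h) hm₀
          · exact (hm i (Finset.mem_range.1 hi) (not_le.1 h)).trans_eq (zero_add m).symm
    _ = largeCount δ n g y * M + n * m := by
        rw [Finset.sum_add_distrib, ← Finset.sum_filter, Finset.sum_const, Finset.sum_const,
          Finset.card_range, nsmul_eq_mul, nsmul_eq_mul, largeCount, Nat.count_eq_card_filter_range]

theorem saturatedSet_zero_subset :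
    saturatedSet B k δ 0 g ⊆ iteratedDerivedSet B (k : Ordinal) := by
  rintro y ⟨j, hj, hy, hk⟩
  rwa [le_antisymm hj (by simpa [largeCount] using hk)] at hy

theorem finite_saturatedSet_inter [CompactSpace X] (hB : IsClosed B)
    (hcount : ∀ j ≤ k, ∀ y ∈ iteratedDerivedSet B (j : Ordinal), largeCount δ n g y + j ≤ k)
    (hΩ : (iteratedDerivedSet B (k : Ordinal) ∩ Ω).Finite) :
    (saturatedSet B k δ n g ∩ Ω).Finite := by
  have hlevel : ∀ j ∈ Iio k, {y ∈ iteratedDerivedSet B (j : Ordinal) |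
      k ≤ largeCount δ n g y + j}.Finite := fun j hj => by
    by_contra hinf
    obtain ⟨p, hp⟩ := Set.Infinite.exists_accPt_principal hinf
    have hpd : p ∈ derivedSet (iteratedDerivedSet B (j : Ordinal)) :=
      derivedSet_mono _ _ (fun y hy => hy.1) hp
    have hpB : p ∈ iteratedDerivedSet B ((j + 1 : ℕ) : Ordinal) := by
      rw [iteratedDerivedSet_natCast_succ]
      exact ⟨hpd, (isClosed_iff_derivedSet_subset _).1 (isClosed_iteratedDerivedSet hB _) hpd⟩
    obtain ⟨y, hy, hyp⟩ := ((accPt_iff_frequently.1 hp).and_eventually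
      (eventually_largeCount_le δ n g p)).exists
    have := hcount (j + 1) hj p hpB
    have := hy.2.2
    omega
  refine (((finite_Iio k).biUnion hlevel).union hΩ).subset fun y hy => ?_
  obtain ⟨⟨j, hj, hyj, hk⟩, hyΩ⟩ := hy
  rcases hj.eq_or_lt with rfl | hlt
  · exact .inr ⟨hyj, hyΩ⟩
  · exact .inl (mem_biUnion hlt ⟨hyj, hk⟩)

end Counting

variable {K₁ K₂ E₁ E₂ : Type*}
  [TopologicalSpace K₁] [CompactSpace K₁] [TopologicalSpace K₂]
  [NormedAddCommGroup E₁] [NormedSpace ℝ E₁] [NormedAddCommGroup E₂]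

/-- Functions `h 0, …, h (n - 1)` in `H` which, up to the tolerance `δ`, take the value `e` at `x`,
have norm at most one and are nested (`h i` is `e` wherever a later `h j` does not vanish), and such
that at a point of `B^(j)` at most `k - j` of their images under `R` are large. -/
structure IsPeakChain {H : Submodule ℝ C(K₁, E₁)} (R : H → C(K₂, E₂)) (B : Set K₂) (k : ℕ)
    (δ : ℝ) (e : E₁) (n : ℕ) (h : ℕ → H) (x : K₁) : Prop where
  near : ∀ i < n, ‖(h i : C(K₁, E₁)) x - e‖ < δ
  norm_le : ∀ i < n, ‖h i‖ ≤ 1 + δ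
  nested : ∀ j < n, ∀ i < j, ∀ z ∈ choquetBoundary H, ‖(h j : C(K₁, E₁)) z‖ ≤ δ ∨
    (‖(h i : C(K₁, E₁)) z - e‖ ≤ δ ∧ (h j : C(K₁, E₁)) z ∈ segment ℝ 0 e)
  count : ∀ j ≤ k, ∀ y ∈ iteratedDerivedSet B (j : Ordinal),
    largeCount δ n (fun i => R (h i)) y + j ≤ k

namespace IsPeakChain

variable {H : Submodule ℝ C(K₁, E₁)} {R : H → C(K₂, E₂)} {B Ω : Set K₂} {k n : ℕ} {δ : ℝ}
  {e : E₁} {h : ℕ → H} {x x' : K₁}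

theorem empty (R : H → C(K₂, E₂)) (B : Set K₂) (k : ℕ) (δ : ℝ) (e : E₁) (h : ℕ → H) (x : K₁) :
    IsPeakChain R B k δ e 0 h x where
  near i hi := absurd hi i.not_lt_zero
  norm_le i hi := absurd hi i.not_lt_zero
  nested j hj := absurd hj j.not_lt_zero
  count j hj y _ := by simpa [largeCount] using hj

theorem snoc (hc : IsPeakChain R B k δ e n h x) (hx' : ∀ i < n, ‖(h i : C(K₁, E₁)) x' - e‖ < δ)
    {u : H} (hnear : ‖(u : C(K₁, E₁)) x' - e‖ < δ) (hnorm : ‖u‖ ≤ 1 + δ)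
    (hnested : ∀ i < n, ∀ z ∈ choquetBoundary H, ‖(u : C(K₁, E₁)) z‖ ≤ δ ∨
      (‖(h i : C(K₁, E₁)) z - e‖ ≤ δ ∧ (u : C(K₁, E₁)) z ∈ segment ℝ 0 e))
    (hsmall : ∀ y ∈ saturatedSet B k δ n fun i => R (h i), ‖R u y‖ < δ) :
    IsPeakChain R B k δ e (n + 1) (Function.update h n u) x' := by
  classical
  have hold : ∀ i < n, Function.update h n u i = h i := fun i hi =>
    Function.update_of_ne hi.ne _ _
  have hnew : Function.update h n u n = u := Function.update_self _ _ _
  refine ⟨Nat.forall_lt_succ_right.2 ⟨fun i hi => ?_, ?_⟩,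
    Nat.forall_lt_succ_right.2 ⟨fun i hi => ?_, ?_⟩,
    Nat.forall_lt_succ_right.2 ⟨fun j hj i hi => ?_, fun i hi => ?_⟩, fun j hj y hy => ?_⟩
  · rw [hold i hi]
    exact hx' i hi
  · rwa [hnew]
  · rw [hold i hi]
    exact hc.norm_le i hi
  · rwa [hnew]
  · rw [hold i (hi.trans hj), hold j hj]
    exact hc.nested j hj i hi
  · rw [hold i hi, hnew]
    exact hnested i hi
  · have hcount := hc.count j hj y hy
    have hcongr := largeCount_congr (δ := δ) (fun i hi => congrArg R (hold i hi)) y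
    rw [largeCount, Nat.count_succ, ← largeCount, hcongr, hnew]
    split_ifs with hlarge
    · by_contra hlt
      exact (hsmall y ⟨j, hj, hy, by omega⟩).not_ge hlarge
    · omega

variable [CompactSpace K₂] [NormedSpace ℝ E₂]

theorem exists_snoc [T2Space K₁] [CompleteSpace E₂] (hE₂ : ¬ ContainsCopy E₂ C₀(ℕ, ℝ))
    {R : H →L[ℝ] C(K₂, E₂)} (hR : ∀ u, ∀ y ∉ Ω, R u y = 0) (hB : IsClosed B)
    (hΩ : (iteratedDerivedSet B (k : Ordinal) ∩ Ω).Finite) (he : ‖e‖ = 1) (hδ : 0 < δ)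
    (hδ₁ : δ < 1) (hc : IsPeakChain R B k δ e n h x) {r : ℕ}
    (hx : x ∈ iteratedDerivedSet (weakPeakPoints H) ((r + 1 : ℕ) : Ordinal)) :
    ∃ u, ∃ x' ∈ iteratedDerivedSet (weakPeakPoints H) (r : Ordinal),
      IsPeakChain R B k δ e (n + 1) (Function.update h n u) x' := by
  let U : Set K₁ := {z | ∀ i < n, ‖(h i : C(K₁, E₁)) z - e‖ < δ}
  have hU : IsOpen U := by
    simp only [U, ofPred_forall]
    exact (finite_Iio n).isOpen_biInter fun i _ =>
      isOpen_lt ((h i : C(K₁, E₁)).continuous.sub continuous_const).norm continuous_const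
  have hxU : U ∈ 𝓝 x := hU.mem_nhds hc.near
  rw [iteratedDerivedSet_natCast_succ] at hx
  have : Finite ↥(saturatedSet B k δ n (fun i => R (h i)) ∩ Ω) :=
    (finite_saturatedSet_inter hB hc.count hΩ).to_subtype
  obtain ⟨x', ⟨hxU', hxW'⟩, f, hf, hfsmall⟩ := exists_isPeakFunction_forall_norm_map_lt hE₂
    (fun y : ↥(saturatedSet B k δ n (fun i => R (h i)) ∩ Ω) =>
      (ContinuousMap.evalCLM ℝ y.1).comp R)
    (Set.Infinite.of_accPt (AccPt.nhds_inter hx.1 hxU))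
    (inter_subset_right.trans (iteratedDerivedSet_subset _ _)) hU inter_subset_left e hδ hδ₁ hδ
  refine ⟨tensorMem hf.mem e, x', hxW', hc.snoc hxU'
    (hf.norm_tensorMem_apply_sub_lt he) ?_ (fun i hi z hz => ?_) fun y hy => ?_⟩
  · linarith [hf.norm_tensorMem_le e]
  · rw [tensorMem_apply]
    by_cases hzU : z ∈ U
    · exact .inr ⟨(hzU i hi).le, 1 - f z, f z, sub_nonneg.2 (hf.le_one z), hf.nonneg z,
        sub_add_cancel _ _, by rw [smul_zero, zero_add]⟩
    · left
      rw [norm_smul, he, mul_one, Real.norm_of_nonneg (hf.nonneg z)]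
      exact (hf.lt_of_notMem z hz hzU).le
  · by_cases hyΩ : y ∈ Ω
    · exact hfsmall ⟨y, hy, hyΩ⟩
    · rwa [hR _ y hyΩ, norm_zero]

theorem exists_add [T2Space K₁] [CompleteSpace E₂] (hE₂ : ¬ ContainsCopy E₂ C₀(ℕ, ℝ))
    {R : H →L[ℝ] C(K₂, E₂)} (hR : ∀ u, ∀ y ∉ Ω, R u y = 0) (hB : IsClosed B)
    (hΩ : (iteratedDerivedSet B (k : Ordinal) ∩ Ω).Finite) (he : ‖e‖ = 1) (hδ : 0 < δ)
    (hδ₁ : δ < 1) (hc : IsPeakChain R B k δ e n h x) {r : ℕ}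
    (hx : x ∈ iteratedDerivedSet (weakPeakPoints H) (r : Ordinal)) :
    ∃ h' x', IsPeakChain R B k δ e (n + r) h' x' := by
  induction r generalizing n h x with
  | zero => exact ⟨h, x, hc⟩
  | succ r ih =>
    obtain ⟨u, x', hx', hc'⟩ := hc.exists_snoc hE₂ hR hB hΩ he hδ hδ₁ hx
    rw [Nat.add_comm r, ← Nat.add_assoc]
    exact ih hc' hx'

end IsPeakChain

end PeakChains

section Distortion

open CantorBendixson
open scoped ZeroAtInfty

theorem norm_two_smul {E : Type*} [SeminormedAddCommGroup E] [NormedSpace ℝ E] (v : E) :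
    ‖(2 : ℝ) • v‖ = 2 * ‖v‖ := by
  rw [norm_smul, Real.norm_ofNat]

theorem norm_two_smul_sub_le_of_mem_segment {E : Type*} [SeminormedAddCommGroup E]
    [NormedSpace ℝ E] {e v : E} (hv : v ∈ segment ℝ 0 e) : ‖(2 : ℝ) • v - e‖ ≤ ‖e‖ := by
  obtain ⟨s, t, hs, ht, hst, rfl⟩ := hv
  rw [smul_zero, zero_add, show (2 : ℝ) • t • e - e = (2 * t - 1) • e by module, norm_smul]
  exact mul_le_of_le_one_left (norm_nonneg e) (abs_le.2 ⟨by linarith, by linarith⟩)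

theorem sum_range_ite_one_two {k n : ℕ} (hkn : k ≤ n) :
    ∑ i ∈ Finset.range n, (if i < k then (1 : ℝ) else 2) = 2 * n - k := by
  obtain ⟨m, rfl⟩ := Nat.exists_eq_add_of_le hkn
  have hlow : ∑ i ∈ Finset.range k, (if i < k then (1 : ℝ) else 2) = k := by
    rw [Finset.sum_congr rfl fun i hi => if_pos (Finset.mem_range.1 hi)]
    simp
  rw [Finset.sum_range_add, hlow]
  simp only [Nat.not_lt.2 (Nat.le_add_right k _), if_false, Finset.sum_const, Finset.card_range,
    nsmul_eq_mul]
  push_cast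
  ring

theorem le_of_forall_pos_of_lt_one_of_continuous {f g : ℝ → ℝ} (hf : Continuous f)
    (hg : Continuous g) (h : ∀ δ, 0 < δ → δ < 1 → f δ ≤ g δ) : f 0 ≤ g 0 :=
  ContinuousWithinAt.closure_le (s := Ioo 0 1) (by simp [closure_Ioo])
    hf.continuousWithinAt hg.continuousWithinAt fun δ hδ => h δ hδ.1 hδ.2

variable {K₁ K₂ E₁ E₂ : Type*}
  [TopologicalSpace K₁] [CompactSpace K₁] [TopologicalSpace K₂]
  [NormedAddCommGroup E₁] [NormedSpace ℝ E₁] [NormedAddCommGroup E₂]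
  {H : Submodule ℝ C(K₁, E₁)} {B : Set K₂} {k l n : ℕ} {δ b M : ℝ} {e : E₁} {h : ℕ → H} {x : K₁}

theorem mul_one_sub_le_norm_of_norm_apply_sub_le {u : H} (he : ‖e‖ = 1) (hM : 0 ≤ M)
    (hu : ‖(u : C(K₁, E₁)) x - M • e‖ ≤ M * δ) : M * (1 - δ) ≤ ‖u‖ := by
  have hMe : ‖M • e‖ = M := by rw [norm_smul, he, mul_one, Real.norm_of_nonneg hM]
  have hux : ‖(u : C(K₁, E₁)) x‖ ≤ ‖u‖ := (u : C(K₁, E₁)).norm_coe_le_norm x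
  linarith [norm_sub_norm_le (M • e) ((u : C(K₁, E₁)) x),
    norm_sub_rev (M • e) ((u : C(K₁, E₁)) x)]

namespace IsPeakChain

section Metric

variable {R : H → C(K₂, E₂)}

theorem exists_le_norm_apply_lt (hc : IsPeakChain R B k δ e n h x) {y : K₂} (hy : y ∈ B)
    (hkn : k < n) :
    ∃ j ≤ k, ‖R (h j) y‖ < δ := by
  obtain ⟨j, hj, hsmall⟩ := exists_lt_norm_lt_of_largeCount_lt (m := k + 1) hkn
    (Nat.lt_succ_of_le (hc.count 0 k.zero_le y (by simpa using hy)))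
  exact ⟨j, Nat.lt_succ_iff.1 hj, hsmall⟩

theorem sum_mul_one_sub_le_norm (hc : IsPeakChain R B k δ e n h x) (he : ‖e‖ = 1) {w : ℕ → ℝ}
    (hw : ∀ i, 0 ≤ w i) :
    (∑ i ∈ Finset.range n, w i) * (1 - δ) ≤ ‖∑ i ∈ Finset.range n, w i • h i‖ := by
  refine mul_one_sub_le_norm_of_norm_apply_sub_le (x := x) he
    (Finset.sum_nonneg fun i _ => hw i) ?_
  have hsplit : ((∑ i ∈ Finset.range n, w i • h i : H) : C(K₁, E₁)) x -
      (∑ i ∈ Finset.range n, w i) • e =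
      ∑ i ∈ Finset.range n, w i • ((h i : C(K₁, E₁)) x - e) := by
    simp [smul_sub, Finset.sum_sub_distrib, Finset.sum_smul]
  rw [hsplit, Finset.sum_mul]
  refine norm_sum_le_of_le _ fun i hi => ?_
  rw [norm_smul, Real.norm_of_nonneg (hw i)]
  exact mul_le_mul_of_nonneg_left (hc.near i (Finset.mem_range.1 hi)).le (hw i)

theorem three_mul_one_sub_le_norm (hc : IsPeakChain R B k δ e n h x) (he : ‖e‖ = 1) {i j : ℕ}
    (hi : i < n) (hj : j < n) : 3 * (1 - δ) ≤ ‖(2 : ℝ) • h j + h i‖ := by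
  refine mul_one_sub_le_norm_of_norm_apply_sub_le (x := x) he zero_le_three ?_
  calc ‖((2 : ℝ) • (h j : C(K₁, E₁)) x + (h i : C(K₁, E₁)) x) - (3 : ℝ) • e‖
      = ‖(2 : ℝ) • ((h j : C(K₁, E₁)) x - e) + ((h i : C(K₁, E₁)) x - e)‖ := by
        congr 1
        module
    _ ≤ 2 * δ + δ := norm_add_le_of_le
        ((norm_two_smul _).trans_le (by linarith [hc.near j hj])) (hc.near i hi).le
    _ = 3 * δ := by ring

theorem norm_two_smul_sub_le (hc : IsPeakChain R B k δ e n h x) (he : ‖e‖ = 1) (hδ : 0 ≤ δ)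
    {i j : ℕ} (hij : i < j) (hj : j < n) : ‖(2 : ℝ) • h j - h i‖ ≤ 1 + 3 * δ := by
  refine norm_le_of_forall_choquetBoundary _ (by positivity) fun z hz => ?_
  simp only [Submodule.coe_sub, Submodule.coe_smul, ContinuousMap.sub_apply,
    ContinuousMap.smul_apply]
  rcases hc.nested j hj i hij z hz with hsmall | ⟨hi, hseg⟩
  · have hiz := ((h i : C(K₁, E₁)).norm_coe_le_norm z).trans (hc.norm_le i (hij.trans hj))
    exact (norm_sub_le_of_le ((norm_two_smul _).trans_le (by gcongr)) hiz).trans (by linarith)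
  · rw [← sub_sub_sub_cancel_right _ _ e]
    exact (norm_sub_le_of_le ((norm_two_smul_sub_le_of_mem_segment hseg).trans_eq he) hi).trans
      (by linarith)

theorem norm_two_smul_sub_two_smul_sub_le (hc : IsPeakChain R B k δ e n h x) (he : ‖e‖ = 1)
    (hδ : 0 ≤ δ) {m i j : ℕ} (hmi : m < i) (hij : i < j) (hj : j < n) :
    ‖(2 : ℝ) • h j - ((2 : ℝ) • h i - h m)‖ ≤ 1 + 5 * δ := by
  refine norm_le_of_forall_choquetBoundary _ (by positivity) fun z hz => ?_
  by_cases hsmall : ‖(h j : C(K₁, E₁)) z‖ ≤ δ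
  · have hrest := (((2 : ℝ) • h i - h m : H) : C(K₁, E₁)).norm_coe_le_norm z |>.trans
      (hc.norm_two_smul_sub_le he hδ hmi (hij.trans hj))
    refine (norm_sub_le_of_le ((norm_two_smul _).trans_le ?_) hrest).trans (?_ : 2 * δ + _ ≤ _)
    · gcongr
    · linarith
  · obtain ⟨hm, hseg⟩ := (hc.nested j hj m (hmi.trans hij) z hz).resolve_left hsmall
    obtain ⟨hi, -⟩ := (hc.nested j hj i hij z hz).resolve_left hsmall
    calc ‖(2 : ℝ) • (h j : C(K₁, E₁)) z -
          ((2 : ℝ) • (h i : C(K₁, E₁)) z - (h m : C(K₁, E₁)) z)‖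
        = ‖((2 : ℝ) • (h j : C(K₁, E₁)) z - e) - ((2 : ℝ) • ((h i : C(K₁, E₁)) z - e) -
          ((h m : C(K₁, E₁)) z - e))‖ := by
          congr 1
          module
      _ ≤ 1 + (2 * δ + δ) := norm_sub_le_of_le
          ((norm_two_smul_sub_le_of_mem_segment hseg).trans_eq he)
          (norm_sub_le_of_le ((norm_two_smul _).trans_le (by gcongr)) hm)
      _ ≤ 1 + 5 * δ := by linarith

end Metric

end IsPeakChain

variable [NormedSpace ℝ E₂]

theorem exists_almost_attaining_norm_map_apply_lt [T2Space K₁] [Nontrivial E₁] [CompleteSpace E₂]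
    (hE₂ : ¬ ContainsCopy E₂ C₀(ℕ, ℝ)) (R : H →L[ℝ] C(K₂, E₂)) {W : Set K₁}
    (hW : W ⊆ weakPeakPoints H) {D : Set K₂}
    (hcases : (W.Nonempty ∧ D = ∅) ∨ (W.Infinite ∧ D.Finite) ∨
      (W.Finite ∧ D.Finite ∧ ¬ ContainsCopy (Fin D.ncard → E₂) (Fin W.ncard → E₁)))
    (hδ : 0 < δ) (hδ₁ : δ < 1) :
    ∃ e : E₁, ‖e‖ = 1 ∧ ∃ x ∈ W, ∃ u : H, ‖(u : C(K₁, E₁)) x - e‖ < δ ∧ ‖u‖ ≤ 1 + δ ∧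
      ∀ y ∈ D, ‖R u y‖ < δ := by
  obtain ⟨e, he⟩ := exists_norm_eq E₁ zero_le_one
  have hnorm : ∀ {x f} (hf : IsPeakFunction H univ x δ f), ‖tensorMem hf.mem e‖ ≤ 1 + δ :=
    fun hf => (hf.norm_tensorMem_le e).trans (by linarith)
  rcases hcases with ⟨⟨x, hx⟩, rfl⟩ | ⟨hWinf, hD⟩ | ⟨hWfin, hD, hno⟩
  · obtain ⟨f, hf⟩ := exists_isPeakFunction (hW hx) Filter.univ_mem hδ hδ₁
    exact ⟨e, he, x, hx, tensorMem hf.mem e, hf.norm_tensorMem_apply_sub_lt he, hnorm hf,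
      by simp⟩
  · have := hD.to_subtype
    obtain ⟨x, hx, f, hf, hsmall⟩ := exists_isPeakFunction_forall_norm_map_lt hE₂
      (fun y : D => (ContinuousMap.evalCLM ℝ y.1).comp R) hWinf hW isOpen_univ (subset_univ W) e
      hδ hδ₁ hδ
    exact ⟨e, he, x, hx, tensorMem hf.mem e, hf.norm_tensorMem_apply_sub_lt he, hnorm hf,
      fun y hy => hsmall ⟨y, hy⟩⟩
  · have := hWfin.to_subtype
    have := hD.to_subtype
    let x := (Finite.equivFinOfCardEq (Nat.card_coe_set_eq W)).symm
    let y := (Finite.equivFinOfCardEq (Nat.card_coe_set_eq D)).symm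
    obtain ⟨e, he, i, u, hnear, hu, hsmall⟩ := exists_almost_attaining_norm_map_lt hno
      (ContinuousLinearMap.pi fun q => (ContinuousMap.evalCLM ℝ (y q : K₂)).comp R)
      (Subtype.val_injective.comp x.injective) (fun i => hW (x i).2) hδ hδ₁ hδ
    refine ⟨e, he, x i, (x i).2, u, hnear, hu, fun z hz => ?_⟩
    obtain ⟨q, hq⟩ := y.surjective ⟨z, hz⟩
    simpa [hq] using (norm_le_pi_norm _ q).trans_lt hsmall

variable [CompactSpace K₂] {R : H →L[ℝ] C(K₂, E₂)}

theorem norm_map_apply_le {u : H} {c : ℝ} (hu : ‖u‖ ≤ c) (y : K₂) : ‖R u y‖ ≤ ‖R‖ * c :=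
  (ContinuousMap.norm_coe_le_norm _ y).trans (R.le_opNorm_of_le hu)

namespace IsPeakChain

theorem norm_map_two_smul_add_apply_le (hc : IsPeakChain R B k δ e (l + 1) h x) (he : ‖e‖ = 1)
    (hδ : 0 ≤ δ) (hk : 1 ≤ k) (hkl : k ≤ l) {y : K₂} (hy : y ∈ B) :
    ‖R ((2 : ℝ) • h l + h 0) y‖ ≤ ‖R‖ * (1 + 5 * δ) + 2 * δ := by
  obtain ⟨i, hik, hi⟩ := hc.exists_le_norm_apply_lt hy (Nat.lt_succ_of_le hkl)
  have hi₂ : ‖(2 : ℝ) • R (h i) y‖ ≤ 2 * δ := (norm_two_smul _).trans_le (by gcongr)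
  suffices hrest : ‖R ((2 : ℝ) • h l + h 0) y - (2 : ℝ) • R (h i) y‖ ≤ ‖R‖ * (1 + 5 * δ) by
    simpa only [sub_add_cancel] using norm_add_le_of_le hrest hi₂
  rw [← ContinuousMap.smul_apply, ← ContinuousMap.sub_apply, ← map_smul, ← map_sub]
  refine norm_map_apply_le ?_ y
  rcases i.eq_zero_or_pos with rfl | hi₀
  · rw [show (2 : ℝ) • h l + h 0 - (2 : ℝ) • h 0 = (2 : ℝ) • h l - h 0 by module]
    exact (hc.norm_two_smul_sub_le he hδ (by omega) l.lt_succ_self).trans (by linarith)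
  rcases (hik.trans hkl).eq_or_lt with rfl | hil
  · rw [add_sub_cancel_left]
    exact (hc.norm_le 0 (Nat.succ_pos _)).trans (by linarith)
  · rw [← sub_sub_eq_add_sub]
    exact hc.norm_two_smul_sub_two_smul_sub_le he hδ hi₀ hil l.lt_succ_self

theorem weight_mul_norm_map_apply_le (hc : IsPeakChain R B k δ e n h x) (he : ‖e‖ = 1)
    (hδ : 0 ≤ δ) {y : K₂} (hy : y ∈ B) {i : ℕ} (hi : i < n) (hlarge : δ ≤ ‖R (h i) y‖) :
    (if i < k then 1 else 2) * ‖R (h i) y‖ ≤ ‖R‖ * (1 + 3 * δ) + δ := by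
  split_ifs with hik
  · calc 1 * ‖R (h i) y‖ ≤ ‖R‖ * (1 + δ) :=
          (one_mul _).trans_le (norm_map_apply_le (hc.norm_le i hi) y)
      _ ≤ ‖R‖ * (1 + 3 * δ) + δ := by nlinarith [norm_nonneg R]
  · obtain ⟨j, hjk, hj⟩ := hc.exists_le_norm_apply_lt hy ((not_lt.1 hik).trans_lt hi)
    have hji : j < i := (hjk.trans (not_lt.1 hik)).lt_of_ne fun hji =>
      hlarge.not_gt (hji ▸ hj)
    have hdiff : ‖(2 : ℝ) • R (h i) y - R (h j) y‖ ≤ ‖R‖ * (1 + 3 * δ) := by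
      simpa only [map_sub, map_smul, ContinuousMap.sub_apply, ContinuousMap.smul_apply] using
        norm_map_apply_le (R := R) (hc.norm_two_smul_sub_le he hδ hji hi) y
    rw [← norm_two_smul]
    simpa only [sub_add_cancel] using norm_add_le_of_le hdiff hj.le

theorem norm_map_sum_apply_le (hc : IsPeakChain R B k δ e n h x) (he : ‖e‖ = 1) (hδ : 0 ≤ δ)
    {y : K₂} (hy : y ∈ B) :
    ‖R (∑ i ∈ Finset.range n, (if i < k then (1 : ℝ) else 2) • h i) y‖ ≤
      k * (‖R‖ * (1 + 3 * δ) + δ) + n * (2 * δ) := by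
  calc ‖R (∑ i ∈ Finset.range n, (if i < k then (1 : ℝ) else 2) • h i) y‖
      = ‖∑ i ∈ Finset.range n, (if i < k then (1 : ℝ) else 2) • R (h i) y‖ := by
        simp only [map_sum, map_smul, ContinuousMap.sum_apply, ContinuousMap.smul_apply]
    _ ≤ ∑ i ∈ Finset.range n, (if i < k then 1 else 2) * ‖R (h i) y‖ :=
        norm_sum_le_of_le _ fun i _ => by split_ifs <;> simp [norm_smul]
    _ ≤ largeCount δ n (fun i => R (h i)) y * (‖R‖ * (1 + 3 * δ) + δ) + n * (2 * δ) :=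
        sum_le_largeCount_mul_add
          (fun i hi => hc.weight_mul_norm_map_apply_le he hδ hy hi)
          (fun i _ hsmall => by split_ifs <;> linarith) (by positivity)
    _ ≤ k * (‖R‖ * (1 + 3 * δ) + δ) + n * (2 * δ) := by
        gcongr
        exact hc.count 0 k.zero_le y (by simpa using hy)

end IsPeakChain

theorem three_le_of_forall_exists_isPeakChain
    (hlow : ∀ u c, 0 ≤ c → (∀ y ∈ B, ‖R u y‖ ≤ c) → ‖u‖ ≤ b * c) (hk : 1 ≤ k) (hkl : k ≤ l)
    (hchain : ∀ δ : ℝ, 0 < δ → δ < 1 → ∃ e h x, ‖e‖ = 1 ∧ IsPeakChain R B k δ e (l + 1) h x) :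
    3 ≤ ‖R‖ * b := by
  have hlimit := le_of_forall_pos_of_lt_one_of_continuous (f := fun δ => 3 * (1 - δ))
    (g := fun δ => b * (‖R‖ * (1 + 5 * δ) + 2 * δ)) (by fun_prop) (by fun_prop)
    fun δ hδ hδ₁ => by
      obtain ⟨e, h, x, he, hc⟩ := hchain δ hδ hδ₁
      exact (hc.three_mul_one_sub_le_norm he l.succ_pos l.lt_succ_self).trans
        (hlow _ _ (by positivity) fun y hy =>
          hc.norm_map_two_smul_add_apply_le he hδ.le hk hkl hy)
  simpa [mul_comm b] using hlimit

theorem two_mul_sub_le_of_forall_exists_isPeakChain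
    (hlow : ∀ u c, 0 ≤ c → (∀ y ∈ B, ‖R u y‖ ≤ c) → ‖u‖ ≤ b * c) (hkn : k ≤ n)
    (hchain : ∀ δ : ℝ, 0 < δ → δ < 1 → ∃ e h x, ‖e‖ = 1 ∧ IsPeakChain R B k δ e n h x) :
    2 * (n : ℝ) - k ≤ ‖R‖ * b * k := by
  have hlimit := le_of_forall_pos_of_lt_one_of_continuous
    (f := fun δ => (2 * (n : ℝ) - k) * (1 - δ))
    (g := fun δ => b * (k * (‖R‖ * (1 + 3 * δ) + δ) + n * (2 * δ))) (by fun_prop) (by fun_prop)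
    fun δ hδ hδ₁ => by
      obtain ⟨e, h, x, he, hc⟩ := hchain δ hδ hδ₁
      rw [← sum_range_ite_one_two hkn]
      exact (hc.sum_mul_one_sub_le_norm he fun i => by split_ifs <;> norm_num).trans
        (hlow _ _ (by positivity) fun y hy => hc.norm_map_sum_apply_le he hδ.le hy)
  simp only [mul_zero, sub_zero, add_zero, mul_one] at hlimit
  linarith

theorem exists_isPeakChain [T2Space K₁] [Nontrivial E₁] [CompleteSpace E₂]
    (hE₂ : ¬ ContainsCopy E₂ C₀(ℕ, ℝ)) {Ω : Set K₂} (hR : ∀ u, ∀ y ∉ Ω, R u y = 0)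
    (hB : IsClosed B) {W : Set K₁}
    (hW : W = iteratedDerivedSet (weakPeakPoints H) (l : Ordinal)) {D : Set K₂}
    (hD : D = iteratedDerivedSet B (k : Ordinal) ∩ Ω)
    (hcases : (W.Nonempty ∧ D = ∅) ∨ (W.Infinite ∧ D.Finite) ∨
      (W.Finite ∧ D.Finite ∧ ¬ ContainsCopy (Fin D.ncard → E₂) (Fin W.ncard → E₁)))
    (hδ : 0 < δ) (hδ₁ : δ < 1) :
    ∃ e h x, ‖e‖ = 1 ∧ IsPeakChain R B k δ e (l + 1) h x := by
  have hDfin : D.Finite := by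
    rcases hcases with ⟨-, rfl⟩ | ⟨-, hD⟩ | ⟨-, hD, -⟩
    exacts [finite_empty, hD, hD]
  obtain ⟨e, he, x, hx, u, hnear, hnorm, hsmall⟩ := exists_almost_attaining_norm_map_apply_lt hE₂ R
    (hW.trans_subset (iteratedDerivedSet_subset _ _)) hcases hδ hδ₁
  have hfirst : IsPeakChain R B k δ e 1 (Function.update 0 0 u) x :=
    (IsPeakChain.empty R B k δ e 0 x).snoc (by simp) hnear hnorm (by simp) fun y hy => by
      by_cases hyΩ : y ∈ Ω
      · exact hsmall y (hD ▸ ⟨saturatedSet_zero_subset hy, hyΩ⟩)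
      · rwa [hR u y hyΩ, norm_zero]
  obtain ⟨h, x', hc⟩ := hfirst.exists_add hE₂ hR hB (hD ▸ hDfin) he hδ hδ₁ (hW ▸ hx)
  exact ⟨e, h, x', he, Nat.add_comm 1 l ▸ hc⟩

end Distortion

theorem theorem1p3_general
    {K₁ K₂ E₁ E₂ : Type*}
    [TopologicalSpace K₁] [CompactSpace K₁] [T2Space K₁]
    [TopologicalSpace K₂] [CompactSpace K₂]
    [NormedAddCommGroup E₁] [NormedSpace ℝ E₁] [Nontrivial E₁]
    [NormedAddCommGroup E₂] [NormedSpace ℝ E₂] [CompleteSpace E₂]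
    (H₁ : Submodule ℝ C(K₁, E₁)) (H₂ : Submodule ℝ C(K₂, E₂))
    (hc₀ : ¬ ContainsCopy E₂ (ZeroAtInftyContinuousMap ℕ ℝ))
    (B : Set K₂) (hBclosed : IsClosed B) (hB : IsBoundaryFor B H₂)
    (F : Submodule ℝ C(K₂, E₂)) (hF : F ≤ H₂) (T : H₁ ≃L[ℝ] F)
    (l k : ℕ) (hk : 1 ≤ k) (hkl : k ≤ l)
    (W : Set K₁) (hW : W = CantorBendixson.iteratedDerivedSet (weakPeakPoints H₁) (l : Ordinal))
    (D : Set K₂)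
    (hD : D = CantorBendixson.iteratedDerivedSet B (k : Ordinal) ∩ nonvanishingSet H₂)
    (hcases :
      (W.Nonempty ∧ D = ∅) ∨
      (W.Infinite ∧ D.Finite) ∨
      (W.Finite ∧ D.Finite ∧ ¬ ContainsCopy (Fin D.ncard → E₂) (Fin W.ncard → E₁))) :
    max 3 ((2 * (l : ℝ) + 2 - (k : ℝ)) / (k : ℝ)) ≤
      ‖(T : H₁ →L[ℝ] F)‖ * ‖(T.symm : F →L[ℝ] H₁)‖ := by
  let R : H₁ →L[ℝ] C(K₂, E₂) := F.subtypeₗᵢ.toContinuousLinearMap.comp (T : H₁ →L[ℝ] F)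
  have hR : ∀ u, R u ∈ H₂ := fun u => hF (T u).2
  have hlow : ∀ u c, 0 ≤ c → (∀ y ∈ B, ‖R u y‖ ≤ c) →
      ‖u‖ ≤ ‖(T.symm : F →L[ℝ] H₁)‖ * c := fun u c hc hu => by
    have hRu : ‖T u‖ ≤ c := (hB (R u) (hR u)).trans_le (Real.iSup_le (fun y => hu y y.2) hc)
    simpa using (T.symm : F →L[ℝ] H₁).le_opNorm_of_le hRu
  have hvanish : ∀ u, ∀ y ∉ nonvanishingSet H₂, R u y = 0 := fun u y hy =>
    by_contra fun hne => hy ⟨R u, hR u, hne⟩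
  have hchain : ∀ δ : ℝ, 0 < δ → δ < 1 → ∃ e h x, ‖e‖ = 1 ∧ IsPeakChain R B k δ e (l + 1) h x :=
    fun δ hδ hδ₁ => exists_isPeakChain hc₀ hvanish hBclosed hW hD hcases hδ hδ₁
  rw [← F.subtypeₗᵢ.norm_toContinuousLinearMap_comp (g := (T : H₁ →L[ℝ] F))]
  refine max_le (three_le_of_forall_exists_isPeakChain hlow hk hkl hchain) ?_
  rw [div_le_iff₀ (by exact_mod_cast hk)]
  calc 2 * (l : ℝ) + 2 - k = 2 * (l + 1 : ℕ) - k := by push_cast; ring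
    _ ≤ _ := two_mul_sub_le_of_forall_exists_isPeakChain hlow (hkl.trans l.le_succ) hchain

theorem theorem1p3
    {K₁ K₂ E₁ E₂ : Type*}
    [TopologicalSpace K₁] [CompactSpace K₁] [T2Space K₁]
    [TopologicalSpace K₂] [CompactSpace K₂] [T2Space K₂]
    [NormedAddCommGroup E₁] [NormedSpace ℝ E₁] [CompleteSpace E₁] [Nontrivial E₁]
    [NormedAddCommGroup E₂] [NormedSpace ℝ E₂] [CompleteSpace E₂] [Nontrivial E₂]
    (H₁ : Submodule ℝ C(K₁, E₁)) (hH₁ : IsClosed (H₁ : Set C(K₁, E₁)))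
    (H₂ : Submodule ℝ C(K₂, E₂)) (hH₂ : IsClosed (H₂ : Set C(K₂, E₂)))
    (hc₀ : ¬ ContainsCopy E₂ (ZeroAtInftyContinuousMap ℕ ℝ))
    (B : Set K₂) (hBclosed : IsClosed B) (hB : IsBoundaryFor B H₂)
    -- an into isomorphism `H₁ → H₂`, i.e. an isomorphism of `H₁` onto a linear subspace `F` of `H₂`
    (F : Submodule ℝ C(K₂, E₂)) (hF : F ≤ H₂) (T : H₁ ≃L[ℝ] F)
    (l k : ℕ) (hk : 1 ≤ k) (hkl : k ≤ l)
    -- `W` is the derivative of order `l` of the set of weak peak points of `H₁`, as a subspace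
    (W : Set K₁) (hW : W = CantorBendixson.iteratedDerivedSet (weakPeakPoints H₁) (l : Ordinal))
    -- `D` is the part of the derivative of order `k` of `B` on which `H₂` does not vanish
    (D : Set K₂)
    (hD : D = CantorBendixson.iteratedDerivedSet B (k : Ordinal) ∩ nonvanishingSet H₂)
    (hcases :
      (W.Nonempty ∧ D = ∅) ∨
      (W.Infinite ∧ D.Finite) ∨
      (W.Finite ∧ D.Finite ∧ ¬ ContainsCopy (Fin D.ncard → E₂) (Fin W.ncard → E₁))) :
    max 3 ((2 * (l : ℝ) + 2 - (k : ℝ)) / (k : ℝ)) ≤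
      ‖(T : H₁ →L[ℝ] F)‖ * ‖(T.symm : F →L[ℝ] H₁)‖ :=
  theorem1p3_general H₁ H₂ hc₀ B hBclosed hB F hF T l k hk hkl W hW D hD hcases
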